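/- Let $H$ be a real separable Hilbert space and $(\iota,H,B)$ an abstract Wiener space: $B$ is a real Banach space, $\iota:H\to B$ a continuous linear injection with dense range and, for $t>0$, $\mu_{B,t}$ is the Borel probability measure on $B$ with $\int_B e^{i\varphi(x)}\,d\mu_{B,t}(x)=e^{-t|\varphi\circ \iota|^2/2}$ for all $\varphi\in B'$ (the norm being that of $H'=H$; thus $B'\subset H'=H\subset B$). Fix $h>0$ and let $\langle\cdot,\cdot\rangle$ be the scalar product of $L^2(B,\mu_{B,h/2})$, linear in the first argument. For $a\in H$, let $\ell_a\in L^2(B,\mu_{B,h/2})$ be given by $\ell_a(x)=a(x)$ if $a\in B'$, and by continuity in $a\in H$ in general; set $\ell_{a+ib}=\ell_a+i\ell_b$. For $X=(a,b)\in H^2$, let $$\Psi_{X,h}(u)=\exp\Big(\tfrac1h\ell_{a+ib}(u)-\tfrac1{2h}|a|^2-\tfrac{i}{2h}\,a\cdot b\Big)\qquad(u\in B).$$ For a finite-dimensional subspace $E\subset H$ with an orthonormal basis $(u_j)$, let $P_E(x)=\sum_j\ell_{u_j}(x)u_j$, and let $\mathcal D_E$ be the space of all $f\in L^2(B,\mu_{B,h/2})$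 of the form $f=\widehat f\circ P_E$ a.e., with $\widehat f:E\to\mathbb C$ continuous, for which $E^2\ni X\mapsto\langle f,\Psi_{X,h}\rangle$ is in the Schwartz space $\mathcal S(E^2)$. Let $\mathcal D=\bigcup_E\mathcal D_E$; it is a vector space that contains all $\Psi_{X,h}$. A quadratic form on $\mathcal D$ is a map $Q:\mathcal D\times\mathcal D\to\mathbb C$, linear in the first and antilinear in the second argument. It is continuous if, for each finite-dimensional $E\subset H$, there are $C>0$ and $m\ge0$ such that, for all $f,g\in\mathcal D_E$, $$|Q(f,g)|\le C\,I(E,m)(f)\,I(E,m)(g),\qquad I(E,m)(f)=\int_{E^2}|\langle f,\Psi_{X,h}\rangle|\,(1+|X|)^m\,dX .$$ Its Wick symbol is the function $X\mapsto Q(\Psi_{X,h},\Psi_{X,h})$ on $H^2$. **Lemma.** If two continuous quadratic forms $Q_1,Q_2$ on $\mathcal D$ have the same Wick symbol, that is, $Q_1(\Psi_{X,h},\Psi_{X,h})=Q_2(\Psi_{X,h},\Psi_{X,h})$ for all $X\in H^2$, then $Q_1=Q_2$, that is, $Q_1(f,g)=Q_2(f,g)$ for all $f,g\in\mathcal D$.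 -/

import Mathlib

open MeasureTheory ProbabilityTheory Topology
open scoped ENNReal NNReal SchwartzMap ContDiff



namespace WienerSpace

/-! ### Schwartz functions of Gaussian type -/

/-- Derivatives of `exp ∘ q` for `q` of temperate growth. -/
lemma norm_iteratedFDeriv_cexp_comp_le {V : Type*} [NormedAddCommGroup V] [NormedSpace ℝ V]
    {q : V → ℂ} (hq : q.HasTemperateGrowth) (n : ℕ) :
    ∃ (l : ℕ) (C : ℝ), 0 ≤ C ∧ ∀ m ≤ n, ∀ X, ‖iteratedFDeriv ℝ m (fun X => Complex.exp (q X)) X‖ ≤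
      C * (1 + ‖X‖) ^ l * Real.exp (q X).re := by
  obtain ⟨k, C, hC, hb⟩ := hq.norm_iteratedFDeriv_le_uniform n
  refine ⟨k * n, n.factorial * (1 + C) ^ n, by positivity, fun m hm X => ?_⟩
  have hX : (1 : ℝ) ≤ 1 + ‖X‖ := by linarith [norm_nonneg X]
  have hD : (1 : ℝ) ≤ (1 + C) * (1 + ‖X‖) ^ k :=
    one_le_mul_of_one_le_of_one_le (by linarith) (one_le_pow₀ hX)
  have hexp : ∀ (i : ℕ) (z : ℂ), ‖iteratedFDeriv ℝ i Complex.exp z‖ ≤ Real.exp z.re := by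
    intro i z
    have h1 : iteratedFDeriv ℝ i Complex.exp z =
        (iteratedFDeriv ℂ i Complex.exp z).restrictScalars ℝ := by
      exact (Complex.contDiff_exp.contDiffAt (n := i)).restrictScalars_iteratedFDeriv.symm
    rw [h1, ContinuousMultilinearMap.norm_restrictScalars, norm_iteratedFDeriv_eq_norm_iteratedDeriv,
      iteratedDeriv_eq_iterate, Complex.iter_deriv_exp, Complex.norm_exp]
  have h := norm_iteratedFDeriv_comp_le (n := m) (N := ∞) (𝕜 := ℝ)
    (Complex.contDiff_exp : ContDiff ℝ ∞ Complex.exp) hq.1 (by exact_mod_cast le_top) X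
    (C := Real.exp (q X).re) (D := (1 + C) * (1 + ‖X‖) ^ k)
    (fun i _ => hexp i _) (fun i hi hin => by
      calc ‖iteratedFDeriv ℝ i q X‖ ≤ C * (1 + ‖X‖) ^ k := hb i (hin.trans hm) X
        _ ≤ (1 + C) * (1 + ‖X‖) ^ k := by gcongr; linarith
        _ ≤ _ := le_self_pow₀ hD (by omega))
  calc _ ≤ _ := h
    _ ≤ n.factorial * Real.exp (q X).re * ((1 + C) * (1 + ‖X‖) ^ k) ^ n := by
        gcongr
    _ = _ := by rw [mul_pow, ← pow_mul]; ring

lemma exists_one_add_pow_mul_exp_le {c : ℝ} (hc : 0 < c) (k : ℕ) :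
    ∃ C : ℝ, 0 ≤ C ∧ ∀ r : ℝ, 0 ≤ r → (1 + r) ^ k * Real.exp (-c * r ^ 2) ≤ C := by
  have hpos : 0 < c / (k + 1) := by positivity
  refine ⟨(1 + (k + 1) / c) ^ k * Real.exp k , by positivity, fun r hr => ?_⟩
  have h1 : 1 + r ≤ (1 + (k + 1) / c) * (1 + c / (k + 1) * r ^ 2 ) := by
    have : (k + 1) / c * (c / (k + 1)) = (1 : ℝ) := by field_simp
    have h0 : 0 ≤ c / (k + 1) * (r - (k + 1) / c) ^ 2 := by positivity
    have h3 : c / (k + 1) * (r - (k + 1) / c) ^ 2 = c / (k + 1) * r ^ 2 - 2 * r + (k + 1) / c := by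
      field_simp
      ring
    have h4 : (1 + (k + 1) / c) * (1 + c / (k + 1) * r ^ 2) =
        1 + (k + 1) / c + c / (k + 1) * r ^ 2 + r ^ 2 := by
      linear_combination r ^ 2 * this
    rw [h4]
    nlinarith [sq_nonneg r]
  have h2 : 1 + c / (k + 1) * r ^ 2 ≤ Real.exp (c / (k + 1) * r ^ 2) := by
    linarith [Real.add_one_le_exp (c / (k + 1) * r ^ 2)]
  calc (1 + r) ^ k * Real.exp (-c * r ^ 2)
      ≤ ((1 + (k + 1) / c) * Real.exp (c / (k + 1) * r ^ 2)) ^ k * Real.exp (-c * r ^ 2) := by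
        gcongr
        exact h1.trans (by gcongr)
    _ = (1 + (k + 1) / c) ^ k * Real.exp (k * (c / (k + 1) * r ^ 2) + -c * r ^ 2) := by
        rw [mul_pow, ← Real.exp_nat_mul, mul_assoc, ← Real.exp_add]
    _ ≤ _ := by
        gcongr
        have : (k : ℝ) * (c / (k + 1) * r ^ 2) ≤ c * r ^ 2 := by
          have e : (k : ℝ) * (c / (k + 1) * r ^ 2) = (k / (k + 1)) * (c * r ^ 2) := by
            field_simp
          rw [e]
          have : (k : ℝ) / (k + 1) ≤ 1 := by rw [div_le_one (by positivity)]; linarith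
          nlinarith [(by positivity : 0 ≤ c * r ^ 2)]
        have : (0 : ℝ) ≤ k := by positivity
        linarith

/-- If `ψ` decays rapidly in the directions `p`, and `exp ∘ q` is Gaussian in the complementary
directions `s`, then `ψ * exp ∘ q` is a Schwartz function. -/
lemma exists_schwartz_mul_cexp {V P S : Type*} [NormedAddCommGroup V] [NormedSpace ℝ V]
    [NormedAddCommGroup P] [NormedSpace ℝ P] [NormedAddCommGroup S] [NormedSpace ℝ S]
    (p : V →L[ℝ] P) (s : V →L[ℝ] S) {K : ℝ} (hK : ∀ X, ‖X‖ ≤ K * (‖p X‖ + ‖s X‖))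
    {ψ : V → ℂ} (hψ : ContDiff ℝ ∞ ψ)
    (hψ' : ∀ k n : ℕ, ∃ C : ℝ, ∀ X, (1 + ‖p X‖) ^ k * ‖iteratedFDeriv ℝ n ψ X‖ ≤ C)
    {q : V → ℂ} (hq : q.HasTemperateGrowth) {c C₀ : ℝ} (hc : 0 < c)
    (hre : ∀ X, (q X).re ≤ C₀ - c * ‖s X‖ ^ 2) :
    ∃ φ : 𝓢(V, ℂ), ∀ X, φ X = ψ X * Complex.exp (q X) := by
  have hE : ContDiff ℝ ∞ (fun X => Complex.exp (q X)) := hq.1.cexp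
  refine ⟨⟨fun X => ψ X * Complex.exp (q X), hψ.mul hE, fun k n => ?_⟩, fun X => rfl⟩
  obtain ⟨l, C₁, hC₁, h₁⟩ := norm_iteratedFDeriv_cexp_comp_le hq n
  obtain ⟨C₂, hC₂, h₂⟩ := exists_one_add_pow_mul_exp_le hc (k + l)
  choose C₃ h₃ using hψ' (k + l)
  set K' := max 1 K with hK'
  have hK1 : 1 ≤ K' := le_max_left _ _
  have hX : ∀ X, 1 + ‖X‖ ≤ K' * ((1 + ‖p X‖) * (1 + ‖s X‖)) := by
    intro X
    have a1 := norm_nonneg (p X)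
    have a2 := norm_nonneg (s X)
    have : ‖X‖ ≤ K' * (‖p X‖ + ‖s X‖) :=
      (hK X).trans (by gcongr; exact le_max_right _ _)
    nlinarith [mul_nonneg a1 a2]
  refine ⟨∑ i ∈ Finset.range (n + 1), n.choose i * C₃ i * (C₁ * Real.exp C₀ * K' ^ (k + l) * C₂),
    fun X => ?_⟩
  have hmul := norm_iteratedFDeriv_mul_le hψ hE X (n := n) (by exact_mod_cast le_top)
  calc ‖X‖ ^ k * ‖iteratedFDeriv ℝ n (fun X => ψ X * Complex.exp (q X)) X‖
      ≤ ‖X‖ ^ k * ∑ i ∈ Finset.range (n + 1), (n.choose i : ℝ) * ‖iteratedFDeriv ℝ i ψ X‖ *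
          ‖iteratedFDeriv ℝ (n - i) (fun X => Complex.exp (q X)) X‖ := by gcongr
    _ = ∑ i ∈ Finset.range (n + 1), ‖X‖ ^ k * ((n.choose i : ℝ) * ‖iteratedFDeriv ℝ i ψ X‖ *
          ‖iteratedFDeriv ℝ (n - i) (fun X => Complex.exp (q X)) X‖) := Finset.mul_sum _ _ _
    _ ≤ _ := by
        refine Finset.sum_le_sum fun i _ => ?_
        have b1 := h₁ (n - i) (Nat.sub_le _ _) X
        have b2 := h₂ ‖s X‖ (norm_nonneg _)
        have b3 := h₃ i X
        have b4 : Real.exp (q X).re ≤ Real.exp C₀ * Real.exp (-c * ‖s X‖ ^ 2) := by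
          rw [← Real.exp_add]; gcongr; linarith [hre X]
        have b5 : ‖X‖ ^ k * (1 + ‖X‖) ^ l ≤
            K' ^ (k + l) * ((1 + ‖p X‖) ^ (k + l) * (1 + ‖s X‖) ^ (k + l)) := by
          rw [← mul_pow, ← mul_pow]
          refine le_trans ?_ (pow_le_pow_left₀ (by positivity) (hX X) _)
          rw [pow_add]
          gcongr
          linarith
        calc ‖X‖ ^ k * ((n.choose i : ℝ) * ‖iteratedFDeriv ℝ i ψ X‖ *
                ‖iteratedFDeriv ℝ (n - i) (fun X => Complex.exp (q X)) X‖)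
            ≤ ‖X‖ ^ k * ((n.choose i : ℝ) * ‖iteratedFDeriv ℝ i ψ X‖ *
                (C₁ * (1 + ‖X‖) ^ l * (Real.exp C₀ * Real.exp (-c * ‖s X‖ ^ 2)))) := by
              gcongr
              exact b1.trans (by gcongr)
          _ = (‖X‖ ^ k * (1 + ‖X‖) ^ l) * ((n.choose i : ℝ) * ‖iteratedFDeriv ℝ i ψ X‖ *
                (C₁ * (Real.exp C₀ * Real.exp (-c * ‖s X‖ ^ 2)))) := by ring
          _ ≤ (K' ^ (k + l) * ((1 + ‖p X‖) ^ (k + l) * (1 + ‖s X‖) ^ (k + l))) *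
                ((n.choose i : ℝ) * ‖iteratedFDeriv ℝ i ψ X‖ *
                (C₁ * (Real.exp C₀ * Real.exp (-c * ‖s X‖ ^ 2)))) := by gcongr
          _ = (n.choose i : ℝ) * ((1 + ‖p X‖) ^ (k + l) * ‖iteratedFDeriv ℝ i ψ X‖) *
                (C₁ * Real.exp C₀ * K' ^ (k + l) *
                ((1 + ‖s X‖) ^ (k + l) * Real.exp (-c * ‖s X‖ ^ 2))) := by ring
          _ ≤ (n.choose i : ℝ) * C₃ i * (C₁ * Real.exp C₀ * K' ^ (k + l) * C₂) := by
              have : 0 ≤ C₃ i := le_trans (by positivity) b3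
              gcongr
/-! ### Abstract Wiener spaces -/

/-- An abstract Wiener space: an injection `incl` with dense range of the Hilbert space `H` into
the Banach space `B`, together with, for every variance `t > 0`, the centered Gaussian Borel
probability measure `gauss t` on `B` whose characteristic functional is
`φ ↦ exp (- t |φ ∘ incl|² / 2)`, where `|φ ∘ incl|` is the norm in `H' = H`. (The values of
`gauss` at `t ≤ 0` play no role.) -/
structure AbstractWienerSpace (H B : Type*) [NormedAddCommGroup H] [InnerProductSpace ℝ H]
    [NormedAddCommGroup B] [NormedSpace ℝ B] [MeasurableSpace B] where
  /-- the injection of `H` into `B` -/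
  incl : H →L[ℝ] B
  injective_incl : Function.Injective incl
  denseRange_incl : DenseRange incl
  /-- the Gaussian measure of variance `t` -/
  gauss : ℝ → Measure B
  isProbabilityMeasure_gauss : ∀ t : ℝ, 0 < t → IsProbabilityMeasure (gauss t)
  charFunDual_gauss : ∀ t : ℝ, 0 < t → ∀ φ : StrongDual ℝ B,
    charFunDual (gauss t) φ = Complex.exp (-(t * ‖φ.comp incl‖ ^ 2 / 2 : ℝ))

noncomputable section

variable {H B : Type*} [NormedAddCommGroup H] [InnerProductSpace ℝ H] [CompleteSpace H]
  [NormedAddCommGroup B] [NormedSpace ℝ B] [MeasurableSpace B]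
  (W : AbstractWienerSpace H B) (h : ℝ)

/-- The Gaussian measure of variance `h / 2` on `B`. -/
abbrev mu : Measure B := W.gauss (h / 2)

instance [hh : Fact (0 < h)] : IsProbabilityMeasure (mu W h) :=
  W.isProbabilityMeasure_gauss _ (half_pos hh.out)

/-- The inclusion `B' ⊂ H' = H`: it sends `φ` to the vector of `H` representing `φ ∘ incl`. -/
def dualIncl : StrongDual ℝ B →ₗ[ℝ] H where
  toFun φ := (InnerProductSpace.toDual ℝ H).symm (φ.comp W.incl)
  map_add' φ ψ := by simp [ContinuousLinearMap.add_comp]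
  map_smul' c φ := by simp [ContinuousLinearMap.smul_comp]

lemma inner_dualIncl (φ : StrongDual ℝ B) (a : H) :
    inner ℝ (dualIncl W φ) a = φ (W.incl a) := by
  simp [dualIncl]

lemma norm_dualIncl (φ : StrongDual ℝ B) : ‖dualIncl W φ‖ = ‖φ.comp W.incl‖ := by
  simp [dualIncl]

lemma denseRange_dualIncl : DenseRange (dualIncl W) := by
  have h1 : (LinearMap.range (dualIncl W)).topologicalClosure = ⊤ := by
    rw [Submodule.topologicalClosure_eq_top_iff, Submodule.eq_bot_iff]
    intro a ha
    have h2 : ∀ φ : StrongDual ℝ B, φ (W.incl a) = 0 := fun φ => by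
      rw [← inner_dualIncl]
      exact (Submodule.mem_orthogonal _ _).1 ha _ ⟨φ, rfl⟩
    have h3 : W.incl a = 0 := by
      by_contra hne
      obtain ⟨φ, -, hφ⟩ := exists_dual_vector ℝ (W.incl a) (by simpa using hne)
      rw [h2 φ] at hφ
      exact hne (by simpa using hφ.symm)
    exact W.injective_incl (by simpa using h3)
  intro x
  have h4 : x ∈ (LinearMap.range (dualIncl W)).topologicalClosure := by rw [h1]; trivial
  exact h4

variable [BorelSpace B] [Fact (0 < h)]

lemma map_dual_eq_gaussianReal (φ : StrongDual ℝ B) :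
    (mu W h).map φ = gaussianReal 0 (h / 2 * ‖dualIncl W φ‖ ^ 2).toNNReal := by
  have hh : 0 < h := Fact.out
  have := Measure.isProbabilityMeasure_map (μ := mu W h) φ.continuous.measurable.aemeasurable
  refine Measure.ext_of_charFun ?_
  funext u
  rw [charFun_map_eq_charFunDual_smul, W.charFunDual_gauss _ (half_pos hh), charFun_gaussianReal]
  congr 1
  rw [Real.coe_toNNReal _ (by positivity), ContinuousLinearMap.smul_comp, norm_smul,
    norm_dualIncl, mul_pow]
  simp
  ring

lemma memLp_dual (φ : StrongDual ℝ B) : MemLp φ 2 (mu W h) := by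
  have := memLp_id_gaussianReal (μ := 0) (v := (h / 2 * ‖dualIncl W φ‖ ^ 2).toNNReal) 2
  rw [← map_dual_eq_gaussianReal] at this
  exact (memLp_map_measure_iff (g := id) (f := φ) (by fun_prop) (by fun_prop)).1 this

/-- A continuous linear form on `B`, as an element of `L²(B, μ_{B,h/2})`. -/
def dualToL2 : StrongDual ℝ B →ₗ[ℝ] Lp ℝ 2 (mu W h) where
  toFun φ := (memLp_dual W h φ).toLp φ
  map_add' φ ψ := (memLp_dual W h φ).toLp_add (memLp_dual W h ψ)
  map_smul' c φ := (memLp_dual W h φ).toLp_const_smul c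

lemma coeFn_dualToL2 (φ : StrongDual ℝ B) : dualToL2 W h φ =ᵐ[mu W h] φ :=
  MemLp.coeFn_toLp (memLp_dual W h φ)

lemma norm_dualToL2_sq (φ : StrongDual ℝ B) :
    ‖dualToL2 W h φ‖ ^ 2 = h / 2 * ‖dualIncl W φ‖ ^ 2 := by
  have hh : 0 < h := Fact.out
  rw [← real_inner_self_eq_norm_sq, L2.inner_def]
  have h1 : ∫ x, inner ℝ (dualToL2 W h φ x) (dualToL2 W h φ x) ∂(mu W h) =
      ∫ x, (φ x) ^ 2 ∂(mu W h) := by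
    refine integral_congr_ae ?_
    filter_upwards [coeFn_dualToL2 W h φ] with x hx
    rw [hx, real_inner_self_eq_norm_sq, Real.norm_eq_abs, sq_abs]
  have h2 : ∫ y, y ^ 2 ∂((mu W h).map φ) = ∫ x, (φ x) ^ 2 ∂(mu W h) :=
    integral_map (by fun_prop) (by fun_prop)
  have h3 := variance_fun_id_gaussianReal (μ := 0) (v := (h / 2 * ‖dualIncl W φ‖ ^ 2).toNNReal)
  rw [variance_eq_integral (by fun_prop)] at h3
  simp only [integral_id_gaussianReal, sub_zero] at h3
  rw [h1, ← h2, map_dual_eq_gaussianReal, h3, Real.coe_toNNReal _ (by positivity)]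

lemma norm_dualToL2 (φ : StrongDual ℝ B) :
    ‖dualToL2 W h φ‖ = √(h / 2) * ‖dualIncl W φ‖ := by
  have hh : 0 < h := Fact.out
  rw [← Real.sqrt_sq (norm_nonneg (dualToL2 W h φ)), norm_dualToL2_sq, Real.sqrt_mul (by positivity),
    Real.sqrt_sq (norm_nonneg _)]

/-- The map `a ↦ ℓ_a`: the continuous extension to `H` of the map which sends `a ∈ B' ⊂ H` to
the class of the function `x ↦ a(x)` in `L²(B, μ_{B,h/2})`. The extension exists, since `B'` is
dense in `H` (`denseRange_dualIncl`) and the map is a multiple of an isometry for the norm of `H`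
(`norm_dualToL2`); see `ell_dualIncl`. -/
def ell : H →L[ℝ] Lp ℝ 2 (mu W h) := (dualToL2 W h).extendOfNorm (dualIncl W)

lemma ell_dualIncl (φ : StrongDual ℝ B) : ell W h (dualIncl W φ) = dualToL2 W h φ :=
  LinearMap.extendOfNorm_eq (denseRange_dualIncl W) ⟨_, fun φ => (norm_dualToL2 W h φ).le⟩ φ

lemma charFun_ell_one (a : H) :
    ∫ x, Complex.exp (ell W h a x * Complex.I) ∂(mu W h) =
      Complex.exp (-(h / 4 * ‖a‖ ^ 2 : ℝ)) := by
  have hh : 0 < h := Fact.out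
  have key : ∀ a b : H, ‖(∫ x, Complex.exp (ell W h a x * Complex.I) ∂(mu W h)) -
      ∫ x, Complex.exp (ell W h b x * Complex.I) ∂(mu W h)‖ ≤ ‖ell W h a - ell W h b‖ := by
    intro a b
    have hi : ∀ a : H, Integrable (fun x => Complex.exp (ell W h a x * Complex.I)) (mu W h) := by
      intro a
      refine Integrable.of_bound (C := 1) ?_ ?_
      · have := (Lp.stronglyMeasurable (ell W h a)).measurable
        exact Measurable.aestronglyMeasurable (by fun_prop)
      · exact Filter.Eventually.of_forall fun x => by rw [Complex.norm_exp_ofReal_mul_I]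
    rw [← integral_sub (hi a) (hi b)]
    have hd : MemLp (ell W h a - ell W h b : Lp ℝ 2 (mu W h)) 2 (mu W h) := Lp.memLp _
    have hd1 : MemLp (ell W h a - ell W h b : Lp ℝ 2 (mu W h)) 1 (mu W h) :=
      hd.mono_exponent (by norm_num)
    calc _ ≤ ∫ x, ‖(ell W h a - ell W h b : Lp ℝ 2 (mu W h)) x‖ ∂(mu W h) := by
          refine norm_integral_le_of_norm_le (memLp_one_iff_integrable.1 hd1).norm ?_
          filter_upwards [Lp.coeFn_sub (ell W h a) (ell W h b)] with x hx
          rw [hx, Pi.sub_apply]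
          have e : Complex.exp (ell W h a x * Complex.I) - Complex.exp (ell W h b x * Complex.I) =
            Complex.exp (ell W h b x * Complex.I) *
              (Complex.exp (Complex.I * (ell W h a x - ell W h b x : ℝ)) - 1) := by
            rw [mul_sub, ← Complex.exp_add, mul_one]; congr 2; push_cast; ring
          rw [e, norm_mul, Complex.norm_exp_ofReal_mul_I, one_mul]
          exact Real.norm_exp_I_mul_ofReal_sub_one_le
      _ = (eLpNorm (ell W h a - ell W h b : Lp ℝ 2 (mu W h)) 1 (mu W h)).toReal := by
          rw [integral_norm_eq_lintegral_enorm hd.1, eLpNorm_one_eq_lintegral_enorm]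
      _ ≤ (eLpNorm (ell W h a - ell W h b : Lp ℝ 2 (mu W h)) 2 (mu W h)).toReal :=
          ENNReal.toReal_mono hd.2.ne
            (eLpNorm_le_eLpNorm_of_exponent_le (by norm_num) hd.1)
      _ = _ := by rw [Lp.norm_def]
  have hc : Continuous fun a : H => ∫ x, Complex.exp (ell W h a x * Complex.I) ∂(mu W h) := by
    rw [continuous_iff_continuousAt]
    intro b
    rw [ContinuousAt, tendsto_iff_norm_sub_tendsto_zero]
    refine squeeze_zero (fun _ => norm_nonneg _) (fun a => key a b) ?_
    have : Continuous fun a => ‖ell W h a - ell W h b‖ := by fun_prop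
    simpa using this.tendsto b
  have hc' : Continuous fun a : H => Complex.exp (-(h / 4 * ‖a‖ ^ 2 : ℝ)) := by fun_prop
  refine congrFun ((denseRange_dualIncl W).equalizer hc hc' ?_) a
  funext φ
  simp only [Function.comp_apply, ell_dualIncl]
  have h1 := W.charFunDual_gauss _ (half_pos hh) φ
  rw [charFunDual_apply] at h1
  rw [norm_dualIncl]
  refine (integral_congr_ae ?_).trans (h1.trans ?_)
  · filter_upwards [coeFn_dualToL2 W h φ] with x hx
    rw [hx]
  · congr 2; ring_nf

/-- The law of `ℓ_a` is the centered Gaussian law of variance `h |a|² / 2`. -/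
lemma map_ell (a : H) :
    (mu W h).map (ell W h a) = gaussianReal 0 (h / 2 * ‖a‖ ^ 2).toNNReal := by
  have hh : 0 < h := Fact.out
  have hm := (Lp.stronglyMeasurable (ell W h a)).measurable
  have := Measure.isProbabilityMeasure_map (μ := mu W h) hm.aemeasurable
  refine Measure.ext_of_charFun ?_
  funext u
  rw [charFun_apply, integral_map hm.aemeasurable (by fun_prop), charFun_gaussianReal]
  have h1 := charFun_ell_one W h (u • a)
  rw [map_smul] at h1
  have h2 : ∫ x, Complex.exp ((inner ℝ (ell W h a x) u : ℝ) * Complex.I) ∂(mu W h) =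
    ∫ x, Complex.exp ((u • ell W h a : Lp ℝ 2 (mu W h)) x * Complex.I) ∂(mu W h) := by
    refine integral_congr_ae ?_
    filter_upwards [Lp.coeFn_smul u (ell W h a)] with x hx
    rw [hx]
    simp
  rw [h2, h1, Real.coe_toNNReal _ (by positivity), norm_smul, mul_pow]
  congr 1
  push_cast
  simp only [Real.norm_eq_abs, ← Complex.ofReal_pow, sq_abs]
  push_cast
  ring

lemma ell_sum_ae {ι : Type*} (s : Finset ι) (c : ι → ℝ) (u : ι → H) :
    ell W h (∑ j ∈ s, c j • u j) =ᵐ[mu W h] fun x => ∑ j ∈ s, c j * ell W h (u j) x := by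
  classical
  induction s using Finset.induction_on with
  | empty =>
    simp only [Finset.sum_empty, map_zero]
    exact Lp.coeFn_zero ℝ 2 (mu W h)
  | insert i s his ih =>
    rw [Finset.sum_insert his, map_add, map_smul]
    filter_upwards [ih, Lp.coeFn_add (c i • ell W h (u i)) (ell W h (∑ j ∈ s, c j • u j)),
      Lp.coeFn_smul (c i) (ell W h (u i))] with x h1 h2 h3
    rw [h2, Pi.add_apply, h3, h1, Finset.sum_insert his]
    rfl

lemma ell_add_ae (a b : H) :
    ell W h (a + b) =ᵐ[mu W h] fun x => ell W h a x + ell W h b x := by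
  rw [map_add]; exact Lp.coeFn_add _ _

lemma ell_sub_ae (a b : H) :
    ell W h (a - b) =ᵐ[mu W h] fun x => ell W h a x - ell W h b x := by
  rw [map_sub]; exact Lp.coeFn_sub _ _

lemma ell_smul_ae (r : ℝ) (a : H) :
    ell W h (r • a) =ᵐ[mu W h] fun x => r * ell W h a x := by
  rw [map_smul]; exact Lp.coeFn_smul _ _

lemma measurable_ell (a : H) : Measurable (ell W h a) :=
  (Lp.stronglyMeasurable (ell W h a)).measurable

/-- The map `P_E : B → E`, `P_E(x) = ∑ j, ℓ_{u_j}(x) u_j`, for an orthonormal basis `(u_j)` of the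
finite dimensional subspace `E` of `H`. Up to null sets it does not depend on the basis, since
`⟨v, P_E(x)⟩ = ℓ_v(x)` almost everywhere for all `v` in `E` (`inner_proj_ae`). -/
def proj (E : Submodule ℝ H) [FiniteDimensional ℝ E] (x : B) : E :=
  ∑ j, ell W h (stdOrthonormalBasis ℝ E j : H) x • stdOrthonormalBasis ℝ E j

lemma inner_proj_ae (E : Submodule ℝ H) [FiniteDimensional ℝ E] (v : E) :
    ell W h (v : H) =ᵐ[mu W h] fun x => inner ℝ v (proj W h E x) := by
  have h1 := ell_sum_ae W h Finset.univ (fun j => inner ℝ (stdOrthonormalBasis ℝ E j) v)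
    (fun j => (stdOrthonormalBasis ℝ E j : H))
  have h2 : ∑ j, inner ℝ (stdOrthonormalBasis ℝ E j) v • (stdOrthonormalBasis ℝ E j : H) = v := by
    conv_rhs => rw [← (stdOrthonormalBasis ℝ E).sum_repr' v]
    simp
  rw [h2] at h1
  filter_upwards [h1] with x hx
  rw [hx, proj, inner_sum]
  refine Finset.sum_congr rfl fun j _ => ?_
  rw [inner_smul_right, real_inner_comm, mul_comm]

section Independence

variable [MeasurableSpace H] [BorelSpace H]

lemma measurable_proj (E : Submodule ℝ H) [FiniteDimensional ℝ E] : Measurable (proj W h E) := by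
  unfold proj
  refine Finset.measurable_sum _ fun j _ => ?_
  exact (measurable_ell W h _).smul_const _

lemma charFun_map_proj (E : Submodule ℝ H) [FiniteDimensional ℝ E] (v : E) :
    charFun ((mu W h).map (proj W h E)) v = Complex.exp (-(h / 4 * ‖v‖ ^ 2 : ℝ)) := by
  rw [charFun_apply, integral_map (measurable_proj W h E).aemeasurable (by fun_prop)]
  have := charFun_ell_one W h (v : H)
  rw [Submodule.norm_coe] at this
  rw [← this]
  refine integral_congr_ae ?_
  filter_upwards [inner_proj_ae W h E v] with x hx
  rw [hx, real_inner_comm]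

/-- `P_E` and `P_F` are independent if `E` and `F` are orthogonal. -/
lemma indepFun_proj {E F : Submodule ℝ H} [FiniteDimensional ℝ E] [FiniteDimensional ℝ F]
    (hEF : E ⟂ F) : IndepFun (proj W h E) (proj W h F) (mu W h) := by
  have mE := measurable_proj W h E
  have mF := measurable_proj W h F
  rw [indepFun_iff_charFun_prod mE.aemeasurable mF.aemeasurable]
  intro t
  rw [charFun_map_proj, charFun_map_proj, charFun_apply,
    integral_map (by fun_prop) (by fun_prop), ← Complex.exp_add]
  have hn : ‖((t.ofLp.1 : H) + (t.ofLp.2 : H))‖ ^ 2 = ‖t.ofLp.1‖ ^ 2 + ‖t.ofLp.2‖ ^ 2 := by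
    have := hEF.inner_eq t.ofLp.1.2 t.ofLp.2.2
    rw [norm_add_sq_real, this]
    simp
  have h1 := charFun_ell_one W h ((t.ofLp.1 : H) + (t.ofLp.2 : H))
  rw [hn] at h1
  have h2 : (((-(h / 4 * ‖t.ofLp.1‖ ^ 2) : ℝ) : ℂ) + ((-(h / 4 * ‖t.ofLp.2‖ ^ 2) : ℝ) : ℂ)) =
      ((-(h / 4 * (‖t.ofLp.1‖ ^ 2 + ‖t.ofLp.2‖ ^ 2)) : ℝ) : ℂ) := by push_cast; ring
  push_cast at h1 h2 ⊢
  rw [h2, ← h1]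
  refine integral_congr_ae ?_
  filter_upwards [inner_proj_ae W h E t.ofLp.1, inner_proj_ae W h F t.ofLp.2,
    ell_add_ae W h (t.ofLp.1 : H) (t.ofLp.2 : H)] with x hx1 hx2 hx3
  rw [hx3, hx1, hx2, WithLp.prod_inner_apply, real_inner_comm, real_inner_comm (proj W h F x)]

end Independence

lemma complexMGF_ell (b : H) (z : ℂ) :
    ∫ x, Complex.exp (z * ell W h b x) ∂(mu W h) = Complex.exp (h / 4 * ‖b‖ ^ 2 * z ^ 2) := by
  have hh : 0 < h := Fact.out
  have := complexMGF_gaussianReal (map_ell W h b) z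
  rw [complexMGF] at this
  rw [this]
  congr 1
  have e : (((h / 2 * ‖b‖ ^ 2).toNNReal : ℝ) : ℂ) = h / 2 * ‖b‖ ^ 2 := by
    rw [Real.coe_toNNReal _ (by positivity)]; push_cast; ring
  rw [e]
  push_cast
  ring

lemma integral_cexp_ell (a b : H) :
    ∫ x, Complex.exp (ell W h a x + Complex.I * ell W h b x) ∂(mu W h) =
      Complex.exp (h / 4 * (‖a‖ ^ 2 - ‖b‖ ^ 2 + 2 * Complex.I * (inner ℝ a b : ℝ))) := by
  borelize H
  set α : ℝ := inner ℝ b a / ‖b‖ ^ 2 with hα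
  set c : H := a - α • b with hc
  have hcb : inner ℝ c b = 0 := by
    rw [hc, inner_sub_left, inner_smul_left, real_inner_self_eq_norm_sq, hα, real_inner_comm]
    by_cases hb : b = 0
    · simp [hb]
    · have : ‖b‖ ≠ 0 := by simpa using hb
      simp only [conj_trivial]
      field_simp
      simp
  have ha : a = c + α • b := by simp [hc]
  have hind : IndepFun (ell W h c) (ell W h b) (mu W h) := by
    have hor : (ℝ ∙ c) ⟂ (ℝ ∙ b) := by
      rw [Submodule.isOrtho_span]
      intro u hu v hv
      rw [Set.mem_singleton_iff.1 hu, Set.mem_singleton_iff.1 hv, hcb]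
    have h1 := indepFun_proj W h hor
    have h2 := h1.comp (φ := fun v => inner ℝ (⟨c, Submodule.mem_span_singleton_self c⟩ : (ℝ ∙ c)) v)
      (ψ := fun v => inner ℝ (⟨b, Submodule.mem_span_singleton_self b⟩ : (ℝ ∙ b)) v)
      (by fun_prop) (by fun_prop)
    exact h2.congr (inner_proj_ae W h _ _).symm (inner_proj_ae W h _ _).symm
  have h3 := (hind.comp (φ := fun r : ℝ => Complex.exp ((1 : ℂ) * r))
    (ψ := fun r : ℝ => Complex.exp ((α + Complex.I) * r)) (by fun_prop)
    (by fun_prop)).integral_fun_mul_eq_mul_integral (by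
      have := measurable_ell W h c; exact Measurable.aestronglyMeasurable (by fun_prop)) (by
      have := measurable_ell W h b; exact Measurable.aestronglyMeasurable (by fun_prop))
  simp only [Function.comp_apply] at h3
  rw [complexMGF_ell, complexMGF_ell, ← Complex.exp_add] at h3
  have h4 : ∫ x, Complex.exp (ell W h a x + Complex.I * ell W h b x) ∂(mu W h) =
      ∫ x, Complex.exp ((1 : ℂ) * ell W h c x) * Complex.exp ((α + Complex.I) * ell W h b x)
        ∂(mu W h) := by
    refine integral_congr_ae ?_
    filter_upwards [ell_add_ae W h c (α • b), ell_smul_ae W h α b] with x h1 h2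
    rw [← ha] at h1
    rw [h1, h2, ← Complex.exp_add]
    congr 1
    push_cast
    ring
  rw [h4, h3]
  congr 1
  have n1 : ‖a‖ ^ 2 = ‖c‖ ^ 2 + α ^ 2 * ‖b‖ ^ 2 := by
    rw [ha, norm_add_sq_real, inner_smul_right, hcb, norm_smul, mul_pow, Real.norm_eq_abs, sq_abs]
    ring
  have n2 : inner ℝ a b = α * ‖b‖ ^ 2 := by
    rw [ha, inner_add_left, hcb, inner_smul_left, real_inner_self_eq_norm_sq]
    simp
  rw [n2, ← Complex.ofReal_pow ‖a‖, n1]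
  push_cast
  linear_combination (h / 4 * ‖b‖ ^ 2 : ℂ) * Complex.I_sq

/-- The coherent state `Ψ_{X,h}` for `X = (a, b)`, as a function on `B`:
`u ↦ exp (ℓ_{a+ib}(u) / h - |a|² / (2h) - i a·b / (2h))`, where `ℓ_{a+ib} = ℓ_a + i ℓ_b`. -/
def coherentFun (X : H × H) (u : B) : ℂ :=
  Complex.exp ((1 / h) * (ell W h X.1 u + Complex.I * ell W h X.2 u) - (1 / (2 * h)) * ‖X.1‖ ^ 2
    - (Complex.I / (2 * h)) * (inner ℝ X.1 X.2 : ℝ))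

lemma measurable_coherentFun (X : H × H) : Measurable (coherentFun W h X) := by
  have h1 := measurable_ell W h X.1
  have h2 := measurable_ell W h X.2
  unfold coherentFun
  fun_prop

lemma memLp_coherentFun (X : H × H) : MemLp (coherentFun W h X) 2 (mu W h) := by
  have hm := (measurable_coherentFun W h X)
  rw [memLp_two_iff_integrable_sq_norm hm.aestronglyMeasurable]
  have h1 : Integrable (fun x => Real.exp (2 / h * ell W h X.1 x)) (mu W h) := by
    have := integrable_exp_mul_gaussianReal (μ := 0) (v := (h / 2 * ‖X.1‖ ^ 2).toNNReal) (2 / h)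
    rw [← map_ell W h] at this
    exact (integrable_map_measure (f := ell W h X.1) (by fun_prop)
      (measurable_ell W h X.1).aemeasurable).1 this
  refine (h1.mul_const (Real.exp (-(1 / h * ‖X.1‖ ^ 2)))).congr ?_
  refine Filter.Eventually.of_forall fun x => ?_
  simp only [coherentFun, Complex.norm_exp]
  rw [← Real.exp_add, ← Real.exp_nat_mul]
  congr 1
  have e : ((1 / h : ℂ) * (ell W h X.1 x + Complex.I * ell W h X.2 x) - (1 / (2 * h)) * ‖X.1‖ ^ 2
    - (Complex.I / (2 * h)) * (inner ℝ X.1 X.2 : ℝ)) =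
    ((1 / h * ell W h X.1 x - 1 / (2 * h) * ‖X.1‖ ^ 2 : ℝ) : ℂ) +
    ((1 / h * ell W h X.2 x - 1 / (2 * h) * inner ℝ X.1 X.2 : ℝ) : ℂ) * Complex.I := by
    push_cast; ring
  rw [e]
  simp only [Complex.add_re, Complex.ofReal_re, Complex.re_ofReal_mul, Complex.I_re, mul_zero,
    add_zero]
  have hh : h ≠ 0 := (Fact.out : 0 < h).ne'
  push_cast
  field_simp
  ring

/-- The coherent state `Ψ_{X,h}` as an element of `L²(B, μ_{B,h/2})`. -/
def coherent (X : H × H) : Lp ℂ 2 (mu W h) := (memLp_coherentFun W h X).toLp (coherentFun W h X)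

lemma coeFn_coherent (X : H × H) : coherent W h X =ᵐ[mu W h] coherentFun W h X :=
  MemLp.coeFn_toLp (memLp_coherentFun W h X)

/-- The scalar product `⟨Ψ_{X,h}, Ψ_{Y,h}⟩ = exp (-(|X|² + |Y|²) / (4h) + X·Y̅ / (2h))`. -/
lemma inner_coherent (X Y : H × H) :
    inner ℂ (coherent W h Y) (coherent W h X) =
      Complex.exp (-(1 / (4 * h)) * ((‖X.1‖ ^ 2 + ‖X.2‖ ^ 2) + (‖Y.1‖ ^ 2 + ‖Y.2‖ ^ 2))
        + (1 / (2 * h)) * ((inner ℝ X.1 Y.1 + inner ℝ X.2 Y.2 : ℝ) +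
            Complex.I * (inner ℝ X.2 Y.1 - inner ℝ X.1 Y.2 : ℝ))) := by
  have hh : (h : ℂ) ≠ 0 := by exact_mod_cast (Fact.out : 0 < h).ne'
  have hh' : h ≠ 0 := (Fact.out : 0 < h).ne'
  rw [L2.inner_def]
  set K : ℂ := -((1 / (2 * h)) * (‖X.1‖ ^ 2 + ‖Y.1‖ ^ 2)) - (Complex.I / (2 * h)) *
    ((inner ℝ X.1 X.2 : ℝ) - (inner ℝ Y.1 Y.2 : ℝ)) with hK
  have h1 : ∫ x, inner ℂ (coherent W h Y x) (coherent W h X x) ∂(mu W h) =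
      ∫ x, Complex.exp (ell W h (h⁻¹ • (X.1 + Y.1)) x +
        Complex.I * ell W h (h⁻¹ • (X.2 - Y.2)) x) * Complex.exp K ∂(mu W h) := by
    refine integral_congr_ae ?_
    filter_upwards [coeFn_coherent W h X, coeFn_coherent W h Y, ell_add_ae W h X.1 Y.1,
      ell_sub_ae W h X.2 Y.2, ell_smul_ae W h h⁻¹ (X.1 + Y.1),
      ell_smul_ae W h h⁻¹ (X.2 - Y.2)] with x e1 e2 e3 e4 e5 e6
    rw [e1, e2, e5, e6, e3, e4, RCLike.inner_apply, coherentFun, coherentFun, ← Complex.exp_conj,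
      ← Complex.exp_add, ← Complex.exp_add]
    congr 1
    simp only [map_sub, map_mul, map_add, map_div₀, Complex.conj_ofReal, Complex.conj_I, map_one,
      map_pow, map_ofNat, hK]
    push_cast
    field_simp
    ring
  rw [h1, integral_mul_const, integral_cexp_ell, ← Complex.exp_add]
  congr 1
  have n1 : ‖h⁻¹ • (X.1 + Y.1)‖ ^ 2 =
      h⁻¹ ^ 2 * (‖X.1‖ ^ 2 + 2 * inner ℝ X.1 Y.1 + ‖Y.1‖ ^ 2) := by
    rw [norm_smul, mul_pow, Real.norm_eq_abs, sq_abs, norm_add_sq_real]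
  have n2 : ‖h⁻¹ • (X.2 - Y.2)‖ ^ 2 =
      h⁻¹ ^ 2 * (‖X.2‖ ^ 2 - 2 * inner ℝ X.2 Y.2 + ‖Y.2‖ ^ 2) := by
    rw [norm_smul, mul_pow, Real.norm_eq_abs, sq_abs, norm_sub_sq_real]
  have n3 : inner ℝ (h⁻¹ • (X.1 + Y.1)) (h⁻¹ • (X.2 - Y.2)) =
      h⁻¹ ^ 2 * (inner ℝ X.1 X.2 - inner ℝ X.1 Y.2 + inner ℝ X.2 Y.1 - inner ℝ Y.1 Y.2) := by
    rw [inner_smul_left, inner_smul_right, inner_add_left, inner_sub_right, inner_sub_right,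
      real_inner_comm X.2 Y.1]
    simp
    ring
  rw [n3, ← Complex.ofReal_pow ‖h⁻¹ • (X.1 + Y.1)‖, n1, ← Complex.ofReal_pow ‖h⁻¹ • (X.2 - Y.2)‖, n2,
    hK]
  push_cast
  field_simp
  ring

/-- The space `𝒟_E`, for a finite dimensional subspace `E` of `H`: the classes of functions
`f = g ∘ P_E` with `g` continuous on `E`, such that `X ↦ ⟨f, Ψ_{X,h}⟩` (scalar product of
`L²(B, μ_{B,h/2})`, linear in `f`) belongs to the Schwartz space of `E × E`. In Mathlib the inner
product is antilinear in its first argument, so `⟨f, Ψ⟩` is `inner ℂ Ψ f`. The sup norm which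
Mathlib puts on `E × E` gives the usual Schwartz space. -/
def domainOn (E : Submodule ℝ H) [FiniteDimensional ℝ E] : Submodule ℂ (Lp ℂ 2 (mu W h)) where
  carrier := {f | (∃ g : E → ℂ, Continuous g ∧ f =ᵐ[mu W h] fun x => g (proj W h E x)) ∧
    ∃ φ : 𝓢(E × E, ℂ), ∀ X : E × E, φ X = inner ℂ (coherent W h (X.1, X.2)) f}
  add_mem' := by
    rintro f₁ f₂ ⟨⟨g₁, hg₁, e₁⟩, φ₁, h₁⟩ ⟨⟨g₂, hg₂, e₂⟩, φ₂, h₂⟩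
    refine ⟨⟨g₁ + g₂, hg₁.add hg₂, ?_⟩, φ₁ + φ₂, fun X => ?_⟩
    · filter_upwards [Lp.coeFn_add f₁ f₂, e₁, e₂] with x a b c
      rw [a, Pi.add_apply, b, c, Pi.add_apply]
    · rw [_root_.add_apply, h₁, h₂, inner_add_right]
  zero_mem' := by
    refine ⟨⟨0, continuous_zero, ?_⟩, 0, fun X => ?_⟩
    · exact Lp.coeFn_zero ℂ 2 (mu W h)
    · rw [_root_.zero_apply, inner_zero_right]
  smul_mem' := by
    rintro c f ⟨⟨g, hg, e⟩, φ, hφ⟩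
    refine ⟨⟨c • g, hg.const_smul c, ?_⟩, c • φ, fun X => ?_⟩
    · filter_upwards [Lp.coeFn_smul c f, e] with x a b
      rw [a, Pi.smul_apply, b, Pi.smul_apply]
    · rw [_root_.smul_apply, hφ, inner_smul_right, smul_eq_mul]

lemma coherentFun_ae_proj (E : Submodule ℝ H) [FiniteDimensional ℝ E] {X : H × H}
    (h1 : X.1 ∈ E) (h2 : X.2 ∈ E) :
    ∃ g : E → ℂ, Continuous g ∧ coherentFun W h X =ᵐ[mu W h] fun x => g (proj W h E x) := by
  refine ⟨fun v => Complex.exp ((1 / h) * ((inner ℝ (⟨X.1, h1⟩ : E) v : ℝ) +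
    Complex.I * (inner ℝ (⟨X.2, h2⟩ : E) v : ℝ)) - (1 / (2 * h)) * ‖X.1‖ ^ 2
    - (Complex.I / (2 * h)) * (inner ℝ X.1 X.2 : ℝ)), by fun_prop, ?_⟩
  filter_upwards [inner_proj_ae W h E ⟨X.1, h1⟩, inner_proj_ae W h E ⟨X.2, h2⟩] with x e1 e2
  rw [coherentFun, e1, e2]

lemma coherent_mem_domainOn (E : Submodule ℝ H) [FiniteDimensional ℝ E] {Y : H × H}
    (h1 : Y.1 ∈ E) (h2 : Y.2 ∈ E) : coherent W h Y ∈ domainOn W h E := by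
  have hh : 0 < h := Fact.out
  refine ⟨?_, ?_⟩
  · obtain ⟨g, hg, e⟩ := coherentFun_ae_proj W h E h1 h2
    exact ⟨g, hg, (coeFn_coherent W h Y).trans e⟩
  · set q : E × E → ℂ := fun X => ((-(1 / (4 * h)) * ((‖X.1‖ ^ 2 + ‖X.2‖ ^ 2) +
        (‖Y.1‖ ^ 2 + ‖Y.2‖ ^ 2)) + (1 / (2 * h)) * (inner ℝ (X.1 : H) Y.1 +
        inner ℝ (X.2 : H) Y.2) : ℝ) : ℂ) - ((1 / (2 * h)) *
          (inner ℝ (X.2 : H) Y.1 - inner ℝ (X.1 : H) Y.2) : ℝ) * Complex.I with hq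
    have hqt : q.HasTemperateGrowth := by
      have a1 : (fun X : E × E => ‖X.1‖ ^ 2).HasTemperateGrowth :=
        (Function.hasTemperateGrowth_norm_sq (H := E)).comp
          (ContinuousLinearMap.fst ℝ E E).hasTemperateGrowth
      have a2 : (fun X : E × E => ‖X.2‖ ^ 2).HasTemperateGrowth :=
        (Function.hasTemperateGrowth_norm_sq (H := E)).comp
          (ContinuousLinearMap.snd ℝ E E).hasTemperateGrowth
      have a3 : ∀ c : H, (fun X : E × E => inner ℝ (X.1 : H) c).HasTemperateGrowth := fun c =>
        (Function.hasTemperateGrowth_inner_left c).comp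
          (E.subtypeL.comp (ContinuousLinearMap.fst ℝ E E)).hasTemperateGrowth
      have a4 : ∀ c : H, (fun X : E × E => inner ℝ (X.2 : H) c).HasTemperateGrowth := fun c =>
        (Function.hasTemperateGrowth_inner_left c).comp
          (E.subtypeL.comp (ContinuousLinearMap.snd ℝ E E)).hasTemperateGrowth
      have c1 : ∀ r : ℝ, (fun _ : E × E => r).HasTemperateGrowth :=
        fun r => Function.HasTemperateGrowth.const r
      have c2 : ∀ r : ℂ, (fun _ : E × E => r).HasTemperateGrowth :=
        fun r => Function.HasTemperateGrowth.const r
      refine Function.HasTemperateGrowth.sub ?_ ?_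
      · exact Function.Complex.hasTemperateGrowth_ofReal.comp
          (((c1 _).mul ((a1.add a2).add (c1 _))).add ((c1 _).mul ((a3 _).add (a4 _))))
      · exact (Function.Complex.hasTemperateGrowth_ofReal.comp
          ((c1 _).mul ((a4 _).sub (a3 _)))).mul (c2 _)
    suffices hex : ∃ φ : 𝓢(E × E, ℂ), ∀ X, φ X = 1 * Complex.exp (q X) by
      obtain ⟨φ, hφ⟩ := hex
      refine ⟨φ, fun X => ?_⟩
      rw [hφ, ← inner_conj_symm, inner_coherent, one_mul, ← Complex.exp_conj]
      congr 1
      simp only [hq, map_mul, map_add, map_div₀, map_neg, Complex.conj_ofReal,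
        Complex.conj_I, map_one, map_pow, map_ofNat, Submodule.coe_norm]
      rw [real_inner_comm Y.1, real_inner_comm Y.2, real_inner_comm Y.1, real_inner_comm Y.2]
      push_cast
      ring
    refine exists_schwartz_mul_cexp (V := E × E) (P := E × E) (S := E × E) 0
      (ContinuousLinearMap.id ℝ (E × E)) (K := 1) (fun X => by simp) (ψ := fun _ => 1)
      contDiff_const (fun k n => ?_) hqt (c := 1 / (8 * h))
      (C₀ := (1 / (4 * h)) * (‖Y.1‖ ^ 2 + ‖Y.2‖ ^ 2)) (by positivity) (fun X => ?_)
    · rcases Nat.eq_zero_or_pos n with rfl | hn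
      · exact ⟨1, fun X => by simp⟩
      · exact ⟨0, fun X => by rw [iteratedFDeriv_const_of_ne hn.ne']; simp⟩
    · simp only [hq, Complex.sub_re, Complex.ofReal_re, Complex.re_ofReal_mul, Complex.I_re,
        mul_zero, sub_zero, ContinuousLinearMap.id_apply]
      have b1 := norm_sub_sq_real (X.1 : H) ((2 : ℝ) • Y.1)
      have b2 := norm_sub_sq_real (X.2 : H) ((2 : ℝ) • Y.2)
      rw [norm_smul, mul_pow, inner_smul_right] at b1 b2
      have b3 : ‖X‖ ^ 2 ≤ ‖X.1‖ ^ 2 + ‖X.2‖ ^ 2 := by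
        rw [Prod.norm_def]
        rcases max_choice ‖X.1‖ ‖X.2‖ with e | e <;> rw [e] <;> nlinarith [sq_nonneg ‖X.1‖, sq_nonneg ‖X.2‖]
      have b4 : 0 ≤ (1 / (8 * h)) * ((‖X.1‖ ^ 2 + ‖X.2‖ ^ 2) - ‖X‖ ^ 2 +
          ‖(X.1 : H) - (2 : ℝ) • Y.1‖ ^ 2 + ‖(X.2 : H) - (2 : ℝ) • Y.2‖ ^ 2) := by
        have : 0 ≤ (‖X.1‖ ^ 2 + ‖X.2‖ ^ 2) - ‖X‖ ^ 2 := by linarith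
        positivity
      rw [b1, b2] at b4
      simp only [Real.norm_ofNat, Submodule.norm_coe] at b4
      refine le_of_sub_nonneg (b4.trans (le_of_eq ?_))
      field_simp
      ring

lemma proj_ae_of_le {E F : Submodule ℝ H} [FiniteDimensional ℝ E] [FiniteDimensional ℝ F]
    (hEF : E ≤ F) :
    proj W h E =ᵐ[mu W h] fun x => E.orthogonalProjectionOnto (proj W h F x : H) := by
  have h1 : ∀ᵐ x ∂(mu W h), ∀ j, inner ℝ (stdOrthonormalBasis ℝ E j) (proj W h E x) =
      inner ℝ (stdOrthonormalBasis ℝ E j) (E.orthogonalProjectionOnto (proj W h F x : H)) := by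
    rw [Filter.eventually_all]
    intro j
    filter_upwards [inner_proj_ae W h E (stdOrthonormalBasis ℝ E j),
      inner_proj_ae W h F ⟨stdOrthonormalBasis ℝ E j, hEF (Subtype.mem _)⟩] with x e1 e2
    rw [← e1, e2]
    exact (Submodule.inner_orthogonalProjectionOnto_eq_of_mem_left (K := E)
      (stdOrthonormalBasis ℝ E j) (proj W h F x : H)).symm
  filter_upwards [h1] with x hx
  exact InnerProductSpace.ext_inner_left_basis (𝕜 := ℝ) (stdOrthonormalBasis ℝ E).toBasis fun j => by simpa using hx j

/-- Factorization of `⟨f, Ψ_{X+Z,h}⟩` for `f` based on `E`, `X ∈ E²` and `Z` orthogonal to `E²`. -/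
lemma inner_coherent_add (E : Submodule ℝ H) [FiniteDimensional ℝ E]
    {f : Lp ℂ 2 (mu W h)} (hf : ∃ g : E → ℂ, Continuous g ∧ f =ᵐ[mu W h] fun x => g (proj W h E x))
    {X Z : H × H} (hX1 : X.1 ∈ E) (hX2 : X.2 ∈ E) (hZ1 : Z.1 ∈ Eᗮ) (hZ2 : Z.2 ∈ Eᗮ) :
    inner ℂ (coherent W h (X + Z)) f =
      inner ℂ (coherent W h X) f * inner ℂ (coherent W h Z) (coherent W h 0) := by
  borelize H
  obtain ⟨g, hg, hfg⟩ := hf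
  obtain ⟨u, hu, hXu⟩ := coherentFun_ae_proj W h E hX1 hX2
  set S : Submodule ℝ H := Submodule.span ℝ {Z.1, Z.2} with hS
  have : FiniteDimensional ℝ S := FiniteDimensional.span_of_finite ℝ (by simp)
  obtain ⟨v, hv, hZv⟩ := coherentFun_ae_proj W h S (X := Z)
    (Submodule.subset_span (by simp)) (Submodule.subset_span (by simp))
  have hES : E ⟂ S := by
    rw [Submodule.isOrtho_comm, Submodule.IsOrtho, hS, Submodule.span_le]
    rintro z (rfl | rfl)
    · exact hZ1
    · exact hZ2
  have hind := (indepFun_proj W h hES).comp (φ := fun w => g w * (starRingEnd ℂ) (u w))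
    (ψ := fun w => (starRingEnd ℂ) (v w)) (by fun_prop) (by fun_prop)
  have mE := measurable_proj W h E
  have mS := measurable_proj W h S
  have h3 := hind.integral_fun_mul_eq_mul_integral
    (Measurable.aestronglyMeasurable (by fun_prop)) (Measurable.aestronglyMeasurable (by fun_prop))
  simp only [Function.comp_apply] at h3
  have o1 : inner ℝ X.1 Z.1 = 0 := hZ1 _ hX1
  have o2 : inner ℝ X.1 Z.2 = 0 := hZ2 _ hX1
  have o3 : inner ℝ X.2 Z.1 = 0 := hZ1 _ hX2
  have o4 : inner ℝ Z.1 X.2 = 0 := by rw [real_inner_comm, o3]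
  have i1 : inner ℂ (coherent W h X) f =
      ∫ x, g (proj W h E x) * (starRingEnd ℂ) (u (proj W h E x)) ∂(mu W h) := by
    rw [L2.inner_def]
    refine integral_congr_ae ?_
    filter_upwards [hfg, hXu, coeFn_coherent W h X] with x e1 e2 e3
    rw [e1, e3, e2, RCLike.inner_apply]
  have h0 : coherentFun W h 0 =ᵐ[mu W h] fun _ => 1 := by
    filter_upwards [Lp.coeFn_zero ℝ 2 (mu W h)] with x e
    simp only [coherentFun, Prod.fst_zero, Prod.snd_zero, map_zero]
    rw [e]
    simp
  have i2 : inner ℂ (coherent W h Z) (coherent W h 0) =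
      ∫ x, (starRingEnd ℂ) (v (proj W h S x)) ∂(mu W h) := by
    rw [L2.inner_def]
    refine integral_congr_ae ?_
    filter_upwards [h0, hZv, coeFn_coherent W h Z, coeFn_coherent W h 0] with x e1 e2 e3 e4
    rw [e3, e2, e4, e1, RCLike.inner_apply, one_mul]
  rw [i1, i2, ← h3, L2.inner_def]
  refine integral_congr_ae ?_
  filter_upwards [hfg, hXu, hZv, coeFn_coherent W h (X + Z), ell_add_ae W h X.1 Z.1,
    ell_add_ae W h X.2 Z.2] with x e1 e2 e3 e4 e5 e6
  rw [e1, e4, ← e2, ← e3, RCLike.inner_apply, mul_assoc, ← map_mul]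
  congr 2
  rw [coherentFun, coherentFun, coherentFun, ← Complex.exp_add, Prod.fst_add, Prod.snd_add, e5, e6]
  congr 1
  have n1 : ‖X.1 + Z.1‖ ^ 2 = ‖X.1‖ ^ 2 + ‖Z.1‖ ^ 2 := by
    rw [norm_add_sq_real, o1]; ring
  rw [← Complex.ofReal_pow ‖X.1 + Z.1‖, n1, inner_add_left, inner_add_right, inner_add_right, o2, o4]
  push_cast
  ring

lemma domainOn_mono {E F : Submodule ℝ H} [FiniteDimensional ℝ E] [FiniteDimensional ℝ F]
    (hEF : E ≤ F) : domainOn W h E ≤ domainOn W h F := by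
  have hh : 0 < h := Fact.out
  rintro f ⟨hf, φ, hφ⟩
  refine ⟨?_, ?_⟩
  · obtain ⟨g, hg, e⟩ := hf
    refine ⟨fun w => g (E.orthogonalProjectionOnto (w : H)), by fun_prop, ?_⟩
    filter_upwards [e, proj_ae_of_le W h hEF] with x e1 e2
    rw [e1, e2]
  · set p₀ : F →L[ℝ] E := E.orthogonalProjectionOnto.comp F.subtypeL with hp₀
    set s₀ : F →L[ℝ] H := F.subtypeL - E.subtypeL.comp p₀ with hs₀
    have hs₀m : ∀ w : F, s₀ w ∈ Eᗮ := fun w => Submodule.sub_starProjection_mem_orthogonal (w : H)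
    have hps : ∀ w : F, (w : H) = (p₀ w : H) + s₀ w := fun w => by simp [hs₀]
    set p : F × F →L[ℝ] E × E := p₀.prodMap p₀ with hp
    set s : F × F →L[ℝ] H × H := s₀.prodMap s₀ with hs
    set q : F × F → ℂ := fun X =>
      ((-(1 / (4 * h)) * (‖(s X).1‖ ^ 2 + ‖(s X).2‖ ^ 2) : ℝ) : ℂ) with hq
    have hqt : q.HasTemperateGrowth := by
      have a1 : (fun X : F × F => ‖(s X).1‖ ^ 2).HasTemperateGrowth :=
        (Function.hasTemperateGrowth_norm_sq (H := H)).comp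
          ((ContinuousLinearMap.fst ℝ H H).comp s).hasTemperateGrowth
      have a2 : (fun X : F × F => ‖(s X).2‖ ^ 2).HasTemperateGrowth :=
        (Function.hasTemperateGrowth_norm_sq (H := H)).comp
          ((ContinuousLinearMap.snd ℝ H H).comp s).hasTemperateGrowth
      exact Function.Complex.hasTemperateGrowth_ofReal.comp
        ((Function.HasTemperateGrowth.const _).mul (a1.add a2))
    suffices hex : ∃ Φ : 𝓢(F × F, ℂ), ∀ X, Φ X = φ (p X) * Complex.exp (q X) by
      obtain ⟨Φ, hΦ⟩ := hex
      refine ⟨Φ, fun X => ?_⟩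
      have hX : ((X.1 : H), (X.2 : H)) = (((p X).1 : H), ((p X).2 : H)) + s X :=
        Prod.ext (hps X.1) (hps X.2)
      rw [hΦ, hφ, hX, inner_coherent_add W h E hf (Subtype.mem _) (Subtype.mem _) (hs₀m X.1)
        (hs₀m X.2), inner_coherent]
      congr 2
      simp [hq]
    refine exists_schwartz_mul_cexp p s (K := 1) (fun X => ?_) (ψ := fun X => φ (p X))
      (φ.smooth'.comp p.contDiff) (fun k n => ?_) hqt (c := 1 / (4 * h)) (C₀ := 0)
      (by positivity) (fun X => ?_)
    · rw [one_mul]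
      have b1 : ‖X.1‖ ≤ ‖p₀ X.1‖ + ‖s₀ X.1‖ := by
        rw [← Submodule.norm_coe, hps X.1]; exact norm_add_le _ _
      have b2 : ‖X.2‖ ≤ ‖p₀ X.2‖ + ‖s₀ X.2‖ := by
        rw [← Submodule.norm_coe, hps X.2]; exact norm_add_le _ _
      rw [Prod.norm_def]
      refine max_le (b1.trans ?_) (b2.trans ?_)
      · exact add_le_add (norm_fst_le (p X)) (norm_fst_le (s X))
      · exact add_le_add (norm_snd_le (p X)) (norm_snd_le (s X))
    · refine ⟨2 ^ k * (Finset.Iic (k, n)).sup (fun m => SchwartzMap.seminorm ℝ m.1 m.2) φ *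
        ‖p‖ ^ n, fun X => ?_⟩
      have c1 := SchwartzMap.one_add_le_sup_seminorm_apply (𝕜 := ℝ) (m := (k, n)) le_rfl le_rfl φ
        (p X)
      have c2 : ‖iteratedFDeriv ℝ n (fun X => φ (p X)) X‖ ≤
          ‖iteratedFDeriv ℝ n φ (p X)‖ * ‖p‖ ^ n := by
        have c3 := p.iteratedFDeriv_comp_right (f := φ) (n := ∞) φ.smooth' X (i := n)
          (by exact_mod_cast le_top)
        have c4 : (fun X => φ (p X)) = φ ∘ p := rfl
        rw [c4, c3]
        refine (ContinuousMultilinearMap.norm_compContinuousLinearMap_le _ _).trans ?_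
        simp
      calc _ ≤ (1 + ‖p X‖) ^ k * (‖iteratedFDeriv ℝ n φ (p X)‖ * ‖p‖ ^ n) := by gcongr
        _ = ((1 + ‖p X‖) ^ k * ‖iteratedFDeriv ℝ n φ (p X)‖) * ‖p‖ ^ n := by ring
        _ ≤ _ := by gcongr
    · have b3 : ‖s X‖ ^ 2 ≤ ‖(s X).1‖ ^ 2 + ‖(s X).2‖ ^ 2 := by
        rw [Prod.norm_def]
        rcases max_choice ‖(s X).1‖ ‖(s X).2‖ with e | e <;> rw [e] <;>
          nlinarith [sq_nonneg ‖(s X).1‖, sq_nonneg ‖(s X).2‖]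
      simp only [hq, Complex.ofReal_re]
      have : 0 ≤ 1 / (4 * h) := by positivity
      nlinarith [mul_le_mul_of_nonneg_left b3 this]

/-- The space `𝒟`, union of the spaces `𝒟_E` over all finite dimensional subspaces `E` of `H`. -/
def domain : Submodule ℂ (Lp ℂ 2 (mu W h)) where
  carrier := ⋃ (E : Submodule ℝ H) (_ : FiniteDimensional ℝ E), (domainOn W h E : Set _)
  add_mem' := by
    intro f g hf hg
    simp only [Set.mem_iUnion, SetLike.mem_coe] at hf hg ⊢
    obtain ⟨E, hE, hf⟩ := hf
    obtain ⟨F, hF, hg⟩ := hg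
    exact ⟨E ⊔ F, inferInstance, add_mem (domainOn_mono W h le_sup_left hf)
      (domainOn_mono W h le_sup_right hg)⟩
  zero_mem' := by
    simp only [Set.mem_iUnion, SetLike.mem_coe]
    exact ⟨⊥, inferInstance, zero_mem _⟩
  smul_mem' := by
    intro c f hf
    simp only [Set.mem_iUnion, SetLike.mem_coe] at hf ⊢
    obtain ⟨E, hE, hf⟩ := hf
    exact ⟨E, hE, Submodule.smul_mem _ c hf⟩

lemma coherent_mem_domain (X : H × H) : coherent W h X ∈ domain W h := by
  have hfin : FiniteDimensional ℝ (Submodule.span ℝ {X.1, X.2}) :=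
    FiniteDimensional.span_of_finite ℝ (by simp)
  have := coherent_mem_domainOn W h (Submodule.span ℝ {X.1, X.2}) (Y := X)
    (Submodule.subset_span (by simp)) (Submodule.subset_span (by simp))
  exact Set.mem_iUnion₂.2 ⟨_, hfin, this⟩

/-- `I(E, m)(f) = ∫_{E²} |⟨f, Ψ_{X,h}⟩| (1 + |X|)^m dX`, where `dX` is the Lebesgue measure of the
Euclidean space `E²` and `|X|` is the Euclidean norm. -/
def seminormI [MeasurableSpace H] [BorelSpace H] (E : Submodule ℝ H) [FiniteDimensional ℝ E]
    (m : ℕ) (f : Lp ℂ 2 (mu W h)) : ℝ :=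
  ∫ X : E × E, ‖inner ℂ (coherent W h (X.1, X.2)) f‖ * (1 + √(‖X.1‖ ^ 2 + ‖X.2‖ ^ 2)) ^ m

/-- A quadratic form on `𝒟`: a map `(f, g) ↦ Q(f, g)` on `𝒟 × 𝒟`, linear in `f` and antilinear
in `g`. -/
abbrev QuadForm : Type _ := domain W h →ₗ[ℂ] domain W h →ₗ⋆[ℂ] ℂ

variable {W h}

/-- Continuity of a quadratic form on `𝒟`: for each finite dimensional subspace `E` of `H` there are
`C > 0` and `m ≥ 0` with `|Q(f, g)| ≤ C I(E, m)(f) I(E, m)(g)` for all `f`, `g` in `𝒟_E`. -/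
def QuadForm.IsContinuous [MeasurableSpace H] [BorelSpace H] (Q : QuadForm W h) : Prop :=
  ∀ (E : Submodule ℝ H) [FiniteDimensional ℝ E], ∃ C : ℝ, 0 < C ∧ ∃ m : ℕ,
    ∀ f g : domain W h, (f : Lp ℂ 2 (mu W h)) ∈ domainOn W h E →
      (g : Lp ℂ 2 (mu W h)) ∈ domainOn W h E →
      ‖Q f g‖ ≤ C * seminormI W h E m f * seminormI W h E m g

/-- The Wick symbol `X ↦ Q(Ψ_{X,h}, Ψ_{X,h})` of a quadratic form on `𝒟`, a function on `H²`. -/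
def QuadForm.wickSymbol (Q : QuadForm W h) (X : H × H) : ℂ :=
  Q ⟨coherent W h X, coherent_mem_domain W h X⟩
    ⟨coherent W h X, coherent_mem_domain W h X⟩
end
end WienerSpace

/-- The Bochner integral of an `L¹`-valued map is computed pointwise. -/
theorem coeFn_integral_L1_ae_eq {X Y : Type*} [MeasurableSpace X] [MeasurableSpace Y]
    {μ : Measure X} {ν : Measure Y} [SFinite μ] [SFinite ν] {κ : X → Y →₁[ν] ℂ}
    (hκ : Integrable κ μ) {k : X → Y → ℂ} (hk : Integrable (Function.uncurry k) (μ.prod ν))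
    (hκk : ∀ x, κ x =ᵐ[ν] k x) :
    (∫ x, κ x ∂μ : Y →₁[ν] ℂ) =ᵐ[ν] fun y => ∫ x, k x y ∂μ := by
  refine Integrable.ae_eq_of_forall_setIntegral_eq _ _ (L1.integrable_coeFn _)
    hk.integral_prod_right fun s hs _ => ?_
  have hk' : Integrable (Function.uncurry k) (μ.prod (ν.restrict s)) :=
    hk.mono_measure (Measure.prod_mono le_rfl Measure.restrict_le_self)
  set Λ : (Y →₁[ν] ℂ) →L[ℝ] ℂ :=
    (L1.integralCLM (E := ℂ)).comp (LpToLpRestrictCLM Y ℂ ℝ ν 1 s) with hΛ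
  have hΛa : ∀ f : Y →₁[ν] ℂ, Λ f = ∫ y in s, f y ∂ν := fun f => by
    change L1.integralCLM (LpToLpRestrictCLM Y ℂ ℝ ν 1 s f) = _
    rw [← L1.integral_eq, L1.integral_eq_integral]
    exact integral_congr_ae (LpToLpRestrictCLM_coeFn ℝ s f)
  rw [← hΛa, ← ContinuousLinearMap.integral_comp_comm Λ hκ, ← integral_integral_swap hk']
  refine integral_congr_ae (Filter.Eventually.of_forall fun x => ?_)
  simp only [hΛa]
  exact integral_congr_ae (ae_restrict_of_ae (hκk x))

section Sesquilinear

variable {V L : Type*} [AddCommGroup V] [Module ℂ V] [NormedAddCommGroup L] [NormedSpace ℂ L]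

/-- A linear form which is bounded for the seminorm `‖T ·‖` factors through `T`. -/
theorem exists_continuousLinearMap_apply_eq (T : V →ₗ[ℂ] L) (l : V →ₗ[ℂ] ℂ) {C : ℝ}
    (hl : ∀ f, ‖l f‖ ≤ C * ‖T f‖) : ∃ Λ : L →L[ℂ] ℂ, ∀ f, Λ (T f) = l f := by
  obtain ⟨s, hs⟩ := T.rangeRestrict.exists_rightInverse_of_surjective T.range_rangeRestrict
  have hTs : ∀ y : T.range, T (s y) = y := fun y =>
    congrArg Subtype.val (LinearMap.congr_fun hs y)
  obtain ⟨Λ, hΛ, -⟩ := exists_extension_norm_eq T.range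
    ((l ∘ₗ s).mkContinuous C fun y => (hl (s y)).trans_eq (by rw [hTs]; rfl))
  refine ⟨Λ, fun f => ?_⟩
  have h1 : Λ (T f) = l (s (T.rangeRestrict f)) := hΛ (T.rangeRestrict f)
  have h2 := hl (s (T.rangeRestrict f) - f)
  have h3 : (T.rangeRestrict f : L) = T f := rfl
  rw [map_sub T, hTs, h3, sub_self, norm_zero, mul_zero, norm_le_zero_iff, map_sub,
    sub_eq_zero] at h2
  rw [h1, h2]

variable {T : V →ₗ[ℂ] L} {Q : V →ₗ[ℂ] V →ₗ⋆[ℂ] ℂ} {C : ℝ}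

theorem exists_continuousLinearMap_left (hQ : ∀ f g, ‖Q f g‖ ≤ C * ‖T f‖ * ‖T g‖) (g : V) :
    ∃ Λ : L →L[ℂ] ℂ, ∀ f, Λ (T f) = Q f g :=
  exists_continuousLinearMap_apply_eq T (Q.flip g) (C := C * ‖T g‖) fun f =>
    (hQ f g).trans_eq (by ring)

theorem exists_continuousLinearMap_right (hQ : ∀ f g, ‖Q f g‖ ≤ C * ‖T f‖ * ‖T g‖) (f : V) :
    ∃ Λ : L →L[ℂ] ℂ, ∀ g, Λ (T g) = (starRingEnd ℂ) (Q f g) :=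
  exists_continuousLinearMap_apply_eq T
    { toFun := fun g => (starRingEnd ℂ) (Q f g)
      map_add' := fun a b => by simp
      map_smul' := fun a b => by simp } (C := C * ‖T f‖) fun g => by
        simpa using hQ f g

theorem differentiable_sesquilinear_conj (hQ : ∀ f g, ‖Q f g‖ ≤ C * ‖T f‖ * ‖T g‖) {u v : ℂ → V}
    (hu : Differentiable ℂ fun z => T (u z)) (hv : Differentiable ℂ fun z => T (v z)) :
    Differentiable ℂ fun z => Q (u z) (v ((starRingEnd ℂ) z)) := by
  intro z
  set z' := (starRingEnd ℂ) z with hz'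
  obtain ⟨Λ, hΛ⟩ := exists_continuousLinearMap_left hQ (v z')
  obtain ⟨M, hM⟩ := exists_continuousLinearMap_right hQ (u z)
  have d1 : DifferentiableAt ℂ (fun x => Q (u x) (v z')) z := by
    simp_rw [← hΛ]
    exact Λ.differentiableAt.comp z (hu z)
  have d2 : DifferentiableAt ℂ (fun x => Q (u z) (v ((starRingEnd ℂ) x))) z := by
    have h1 : DifferentiableAt ℂ (fun x => M (T (v x))) z' := M.differentiableAt.comp z' (hv z')
    have h2 := h1.conj_conj
    rw [hz', Complex.conj_conj] at h2
    refine h2.congr_of_eventuallyEq (Filter.Eventually.of_forall fun x => ?_)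
    simp [hM]
  have d3 : HasDerivAt (fun x => Q (u x - u z) (v ((starRingEnd ℂ) x) - v z')) 0 z := by
    rw [hasDerivAt_iff_isLittleO]
    have a1 : (fun x => T (u x) - T (u z)) =O[𝓝 z] fun x => x - z := (hu z).isBigO_sub
    have hc : Filter.Tendsto (starRingEnd ℂ) (𝓝 z) (𝓝 z') := Complex.continuous_conj.tendsto z
    have a2 : (fun x => T (v ((starRingEnd ℂ) x)) - T (v z')) =O[𝓝 z] fun x => x - z := by
      refine ((hv z').isBigO_sub.comp_tendsto hc).trans
        (Asymptotics.isBigO_of_le _ fun x => ?_)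
      simp only [Function.comp_apply, hz', ← map_sub]
      exact (Complex.norm_conj _).le
    have a3 : (fun x => Q (u x - u z) (v ((starRingEnd ℂ) x) - v z')) =O[𝓝 z]
        fun x => (x - z) * (x - z) := by
      refine Asymptotics.IsBigO.trans ?_ (a1.norm_left.mul a2.norm_left)
      refine Asymptotics.IsBigO.of_bound C (Filter.Eventually.of_forall fun x => ?_)
      refine (hQ _ _).trans_eq ?_
      rw [map_sub, map_sub, norm_mul, norm_norm, norm_norm]
      ring
    have a4 : (fun x => (x - z) * (x - z)) =o[𝓝 z] fun x => x - z := by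
      have : (fun x => x - z) =o[𝓝 z] fun _ => (1 : ℂ) := by
        rw [Asymptotics.isLittleO_one_iff]
        have : Continuous fun x => x - z := by fun_prop
        simpa using this.tendsto z
      simpa using this.mul_isBigO (Asymptotics.isBigO_refl (fun x => x - z) (𝓝 z))
    simpa [hz'] using a3.trans_isLittleO a4
  refine (((d1.add d2).sub_const (Q (u z) (v z'))).add d3.differentiableAt).congr_of_eventuallyEq
    (Filter.Eventually.of_forall fun x => ?_)
  simp only [Pi.add_apply, map_sub, LinearMap.sub_apply]
  ring

theorem eq_zero_of_differentiable_of_forall_real {k : ℂ → ℂ} (hk : Differentiable ℂ k)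
    (h0 : ∀ r : ℝ, k r = 0) (z : ℂ) : k z = 0 := by
  refine congrFun (AnalyticOnNhd.eq_of_frequently_eq (z₀ := 0) (g := fun _ => 0)
    (fun z _ => hk.analyticAt z) analyticOnNhd_const ?_) z
  have h1 : Filter.Tendsto (fun r : ℝ => (r : ℂ)) (𝓝[≠] 0) (𝓝[≠] 0) := by
    refine tendsto_nhdsWithin_iff.2 ⟨?_, ?_⟩
    · exact (Complex.continuous_ofReal.tendsto' 0 0 (by simp)).mono_left nhdsWithin_le_nhds
    · filter_upwards [self_mem_nhdsWithin] with r hr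
      simpa using hr
  exact h1.frequently (Filter.Frequently.of_forall h0)

/-- A sesquilinear form which vanishes on the diagonal of a holomorphic curve vanishes off the
diagonal too. -/
theorem sesquilinear_eq_zero_of_diagonal (hQ : ∀ f g, ‖Q f g‖ ≤ C * ‖T f‖ * ‖T g‖) {u : ℂ → V}
    (hu : Differentiable ℂ fun z => T (u z)) (hdiag : ∀ z, Q (u z) (u z) = 0) :
    Q (u 1) (u 0) = 0 := by
  have key : ∀ x y : ℂ, Q (u (x + Complex.I * y))
      (u ((starRingEnd ℂ) x + Complex.I * (starRingEnd ℂ) y)) = 0 := by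
    intro x y
    have hx : ∀ c : ℂ, Differentiable ℂ fun z => T (u (c + Complex.I * z)) := fun c =>
      hu.comp (by fun_prop)
    have hy : ∀ c : ℂ, Differentiable ℂ fun z => T (u (z + Complex.I * c)) := fun c =>
      hu.comp (by fun_prop)
    refine eq_zero_of_differentiable_of_forall_real (k := fun y => Q (u (x + Complex.I * y))
      (u ((starRingEnd ℂ) x + Complex.I * (starRingEnd ℂ) y)))
      (differentiable_sesquilinear_conj hQ (hx x) (hx _)) (fun r => ?_) y
    refine eq_zero_of_differentiable_of_forall_real (k := fun x => Q (u (x + Complex.I * r))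
      (u ((starRingEnd ℂ) x + Complex.I * (starRingEnd ℂ) (r : ℂ))))
      (differentiable_sesquilinear_conj hQ (hy r) (hy _)) (fun t => ?_) x
    simp only [Complex.conj_ofReal]
    exact hdiag _
  have h1 := key (1 / 2) (-(Complex.I / 2))
  have e1 : (1 / 2 : ℂ) + Complex.I * -(Complex.I / 2) = 1 := by
    linear_combination (-1 / 2 : ℂ) * Complex.I_sq
  have e2 : (starRingEnd ℂ) (1 / 2 : ℂ) + Complex.I * (starRingEnd ℂ) (-(Complex.I / 2)) = 0 := by
    simp only [map_div₀, map_neg, map_one, map_ofNat, Complex.conj_I]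
    linear_combination (1 / 2 : ℂ) * Complex.I_sq
  rwa [e1, e2] at h1

end Sesquilinear

/-- `s ↦ p * exp (s * β)` is a holomorphic map into `L¹` if all `p * exp (c * ‖β‖)` are
integrable. -/
theorem differentiable_L1_mul_cexp {Y : Type*} [MeasurableSpace Y] {ν : Measure Y} {p β : Y → ℂ}
    (hp : AEStronglyMeasurable p ν) (hβ : AEStronglyMeasurable β ν)
    (hint : ∀ c : ℝ, Integrable (fun y => ‖p y‖ * Real.exp (c * ‖β y‖)) ν)
    {u : ℂ → Y →₁[ν] ℂ} (hu : ∀ s, u s =ᵐ[ν] fun y => p y * Complex.exp (s * β y)) :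
    Differentiable ℂ u := by
  intro s
  have hE : ∀ y, ‖Complex.exp (s * β y)‖ ≤ Real.exp (‖s‖ * ‖β y‖) := fun y =>
    (Complex.norm_exp_le_exp_norm _).trans_eq (by rw [norm_mul])
  have hβE : ∀ y, ‖β y‖ ≤ Real.exp ‖β y‖ := fun y => by
    linarith [Real.add_one_le_exp ‖β y‖]
  have hDi : Integrable (fun y => p y * (β y * Complex.exp (s * β y))) ν := by
    refine (hint (1 + ‖s‖)).mono' (hp.mul (hβ.mul ?_)) (Filter.Eventually.of_forall fun y => ?_)
    · exact Complex.continuous_exp.comp_aestronglyMeasurable (hβ.const_mul s)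
    · rw [norm_mul, norm_mul, add_mul, one_mul, Real.exp_add]
      gcongr
      exacts [hβE y, hE y]
  set D : Y →₁[ν] ℂ := hDi.toL1 _ with hD
  set M : ℝ := ∫ y, ‖p y‖ * Real.exp ((‖s‖ + 3) * ‖β y‖) ∂ν with hM
  have hbound : ∀ z, ‖z - s‖ ≤ 1 → ‖u z - u s - (z - s) • D‖ ≤ M * ‖(z - s) * (z - s)‖ := by
    intro z hz
    rw [L1.norm_eq_integral_norm, hM, ← integral_mul_const]
    refine integral_mono_ae (L1.integrable_coeFn _).norm ((hint _).mul_const _) ?_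
    filter_upwards [hu z, hu s, Lp.coeFn_sub (u z - u s) ((z - s) • D), Lp.coeFn_sub (u z) (u s),
      Lp.coeFn_smul (z - s) D, hDi.coeFn_toL1] with y e1 e2 e3 e4 e5 e6
    rw [e3, Pi.sub_apply, e4, Pi.sub_apply, e5, Pi.smul_apply, e6, e1, e2, smul_eq_mul]
    have h1 := Complex.norm_exp_sub_sum_le_norm_mul_exp ((z - s) * β y) 2
    simp only [Finset.sum_range_succ, Finset.sum_range_zero, pow_zero, pow_one, Nat.factorial_zero,
      Nat.factorial_one, Nat.cast_one, div_one, zero_add] at h1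
    have h2 : p y * Complex.exp (z * β y) - p y * Complex.exp (s * β y) -
        (z - s) * (p y * (β y * Complex.exp (s * β y))) =
        p y * (Complex.exp (s * β y) *
          (Complex.exp ((z - s) * β y) - (1 + (z - s) * β y))) := by
      have : Complex.exp (z * β y) = Complex.exp (s * β y) * Complex.exp ((z - s) * β y) := by
        rw [← Complex.exp_add]; ring_nf
      rw [this]
      ring
    rw [h2, norm_mul, norm_mul, mul_assoc]
    refine mul_le_mul_of_nonneg_left ?_ (norm_nonneg _)
    have h3 : Real.exp ‖(z - s) * β y‖ ≤ Real.exp ‖β y‖ := by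
      rw [Real.exp_le_exp, norm_mul]
      exact mul_le_of_le_one_left (norm_nonneg _) hz
    have h4 : ‖(z - s) * β y‖ ^ 2 ≤ ‖(z - s) * (z - s)‖ * (Real.exp ‖β y‖) ^ 2 := by
      rw [norm_mul, norm_mul, mul_pow, ← sq]
      gcongr
      exact hβE y
    calc ‖Complex.exp (s * β y)‖ * ‖Complex.exp ((z - s) * β y) - (1 + (z - s) * β y)‖
        ≤ Real.exp (‖s‖ * ‖β y‖) *
            (‖(z - s) * (z - s)‖ * (Real.exp ‖β y‖) ^ 2 * Real.exp ‖β y‖) := by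
          refine mul_le_mul (hE y) (h1.trans ?_) (norm_nonneg _) (Real.exp_pos _).le
          gcongr
      _ = _ := by
          rw [← Real.exp_nat_mul, mul_assoc ‖(z - s) * (z - s)‖, ← Real.exp_add,
            mul_left_comm, ← Real.exp_add, mul_comm]
          congr 2
          push_cast
          ring
  refine HasDerivAt.differentiableAt (f' := D) ?_
  rw [hasDerivAt_iff_isLittleO]
  have b1 : (fun z => u z - u s - (z - s) • D) =O[𝓝 s] fun z => (z - s) * (z - s) := by
    refine Asymptotics.IsBigO.of_bound M ?_
    filter_upwards [Metric.closedBall_mem_nhds s one_pos] with z hz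
    exact hbound z (by rwa [Metric.mem_closedBall, dist_eq_norm] at hz)
  have b2 : (fun z => (z - s) * (z - s)) =o[𝓝 s] fun z => z - s := by
    have : (fun z => z - s) =o[𝓝 s] fun _ => (1 : ℂ) := by
      rw [Asymptotics.isLittleO_one_iff]
      have : Continuous fun z => z - s := by fun_prop
      simpa using this.tendsto s
    simpa using this.mul_isBigO (Asymptotics.isBigO_refl (fun z => z - s) (𝓝 s))
  exact b1.trans_isLittleO b2

namespace WienerSpace

noncomputable section

section Kernel

variable {E : Type*} [NormedAddCommGroup E]

/-- The Euclidean norm on `E × E`. -/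
def eNorm (X : E × E) : ℝ := √(‖X.1‖ ^ 2 + ‖X.2‖ ^ 2)

lemma eNorm_nonneg (X : E × E) : 0 ≤ eNorm X := Real.sqrt_nonneg _

lemma eNorm_sq (X : E × E) : eNorm X ^ 2 = ‖X.1‖ ^ 2 + ‖X.2‖ ^ 2 := Real.sq_sqrt (by positivity)

@[fun_prop]
lemma continuous_eNorm : Continuous (eNorm : E × E → ℝ) := by unfold eNorm; fun_prop

lemma eNorm_add_le (X Y : E × E) : eNorm (X + Y) ≤ eNorm X + eNorm Y := by
  have h1 : ∀ Z : E × E, eNorm Z = ‖WithLp.toLp 2 Z‖ := fun Z => by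
    rw [WithLp.prod_norm_eq_of_L2]; rfl
  rw [h1, h1, h1, WithLp.toLp_add]
  exact norm_add_le _ _

lemma norm_fst_le_eNorm (X : E × E) : ‖X.1‖ ≤ eNorm X :=
  Real.le_sqrt_of_sq_le (by linarith [sq_nonneg ‖X.2‖])

lemma norm_snd_le_eNorm (X : E × E) : ‖X.2‖ ≤ eNorm X :=
  Real.le_sqrt_of_sq_le (by linarith [sq_nonneg ‖X.1‖])

lemma eNorm_le_two_mul_norm (X : E × E) : eNorm X ≤ 2 * ‖X‖ := by
  refine Real.sqrt_le_iff.2 ⟨by positivity, ?_⟩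
  have h1 := norm_fst_le X
  have h2 := norm_snd_le X
  nlinarith [norm_nonneg X.1, norm_nonneg X.2]

/-- The weight `(1 + |X|)^m`. -/
def weight (m : ℕ) (X : E × E) : ℝ := (1 + eNorm X) ^ m

lemma weight_pos (m : ℕ) (X : E × E) : 0 < weight m X :=
  pow_pos (by linarith [eNorm_nonneg X]) m

@[fun_prop]
lemma continuous_weight (m : ℕ) : Continuous (weight m : E × E → ℝ) := by unfold weight; fun_prop

lemma weight_add_le (m : ℕ) (X Y : E × E) : weight m (X + Y) ≤ weight m X * weight m Y := by
  rw [weight, weight, weight, ← mul_pow]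
  have h1 := eNorm_add_le X Y
  have h2 := eNorm_nonneg X
  have h3 := eNorm_nonneg Y
  refine pow_le_pow_left₀ (by linarith [eNorm_nonneg (X + Y)]) ?_ m
  nlinarith [mul_nonneg h2 h3]

variable [InnerProductSpace ℝ E]

/-- The sesquilinear product `(a + ib) · conj (p + iq)` for `X = (a, b)`, `Y = (p, q)`. -/
def herm (X Y : E × E) : ℂ :=
  (inner ℝ X.1 Y.1 + inner ℝ X.2 Y.2 : ℝ) + Complex.I * (inner ℝ X.2 Y.1 - inner ℝ X.1 Y.2 : ℝ)

/-- The reproducing kernel `⟨Ψ_{X,h}, Ψ_{Y,h}⟩`. -/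
def kernel (h : ℝ) (X Y : E × E) : ℂ :=
  Complex.exp (-(1 / (4 * h)) * ((‖X.1‖ ^ 2 + ‖X.2‖ ^ 2) + (‖Y.1‖ ^ 2 + ‖Y.2‖ ^ 2))
    + (1 / (2 * h)) * herm X Y)

/-- Complex multiplication on `E × E`, which is identified with `E ⊗ ℂ`. -/
def complexSMul (s : ℂ) (B : E × E) : E × E := (s.re • B.1 - s.im • B.2, s.re • B.2 + s.im • B.1)

lemma herm_add_complexSMul (A B Y : E × E) (s : ℂ) :
    herm (A + complexSMul s B) Y = herm A Y + s * herm B Y := by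
  conv_rhs => rw [← Complex.re_add_im s]
  simp only [herm, complexSMul, Prod.fst_add, Prod.snd_add, inner_add_left, inner_sub_left,
    inner_smul_left, conj_trivial]
  push_cast
  linear_combination (-(s.im : ℂ) * (inner ℝ B.2 Y.1 - inner ℝ B.1 Y.2)) * Complex.I_sq

@[fun_prop]
lemma continuous_herm {Z : Type*} [TopologicalSpace Z] {f g : Z → E × E} (hf : Continuous f)
    (hg : Continuous g) : Continuous fun z => herm (f z) (g z) := by
  unfold herm; fun_prop

lemma norm_herm_le (X Y : E × E) : ‖herm X Y‖ ≤ 4 * eNorm X * eNorm Y := by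
  have h1 : ∀ a b : E, ‖a‖ ≤ eNorm X → ‖b‖ ≤ eNorm Y → |inner ℝ a b| ≤ eNorm X * eNorm Y :=
    fun a b ha hb => (abs_real_inner_le_norm a b).trans
      (mul_le_mul ha hb (norm_nonneg _) (eNorm_nonneg _))
  have x1 := norm_fst_le_eNorm X
  have x2 := norm_snd_le_eNorm X
  have y1 := norm_fst_le_eNorm Y
  have y2 := norm_snd_le_eNorm Y
  have c1 := abs_le.1 (h1 _ _ x1 y1)
  have c2 := abs_le.1 (h1 _ _ x2 y2)
  have c3 := abs_le.1 (h1 _ _ x2 y1)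
  have c4 := abs_le.1 (h1 _ _ x1 y2)
  unfold herm
  refine (norm_add_le _ _).trans ?_
  rw [norm_mul, Complex.norm_I, one_mul, Complex.norm_real, Complex.norm_real, Real.norm_eq_abs,
    Real.norm_eq_abs]
  have d1 : |inner ℝ X.1 Y.1 + inner ℝ X.2 Y.2| ≤ 2 * (eNorm X * eNorm Y) :=
    abs_le.2 ⟨by linarith, by linarith⟩
  have d2 : |inner ℝ X.2 Y.1 - inner ℝ X.1 Y.2| ≤ 2 * (eNorm X * eNorm Y) :=
    abs_le.2 ⟨by linarith, by linarith⟩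
  linarith

@[fun_prop]
lemma continuous_kernel {Z : Type*} [TopologicalSpace Z] (h : ℝ) {f g : Z → E × E}
    (hf : Continuous f) (hg : Continuous g) : Continuous fun z => kernel h (f z) (g z) := by
  unfold kernel; fun_prop

lemma norm_kernel (h : ℝ) (X Y : E × E) :
    ‖kernel h X Y‖ = Real.exp (-(1 / (4 * h)) * eNorm (X - Y) ^ 2) := by
  have e : (-(1 / (4 * h)) * ((‖X.1‖ ^ 2 + ‖X.2‖ ^ 2) + (‖Y.1‖ ^ 2 + ‖Y.2‖ ^ 2))
    + (1 / (2 * h)) * herm X Y : ℂ) =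
    ((-(1 / (4 * h)) * ((‖X.1‖ ^ 2 + ‖X.2‖ ^ 2) + (‖Y.1‖ ^ 2 + ‖Y.2‖ ^ 2)) + (1 / (2 * h)) *
      (inner ℝ X.1 Y.1 + inner ℝ X.2 Y.2) : ℝ) : ℂ) +
    (((1 / (2 * h)) * (inner ℝ X.2 Y.1 - inner ℝ X.1 Y.2) : ℝ) : ℂ) * Complex.I := by
    unfold herm; push_cast; ring
  rw [kernel, Complex.norm_exp, e, Complex.add_re, Complex.ofReal_re, Complex.re_ofReal_mul,
    Complex.I_re, mul_zero, add_zero, eNorm_sq, Prod.fst_sub, Prod.snd_sub, norm_sub_sq_real,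
    norm_sub_sq_real]
  congr 1
  ring

lemma norm_kernel_le {h : ℝ} (hh : 0 < h) (X Y : E × E) :
    ‖kernel h X Y‖ ≤
      Real.exp ((1 / (4 * h)) * eNorm X ^ 2) * Real.exp (-(1 / (8 * h)) * eNorm Y ^ 2) := by
  rw [norm_kernel, ← Real.exp_add, Real.exp_le_exp]
  have h1 : eNorm Y ≤ eNorm (X - Y) + eNorm X := by
    have h2 := eNorm_add_le (Y - X) X
    have h3 : eNorm (Y - X) = eNorm (X - Y) := by
      simp only [eNorm, Prod.fst_sub, Prod.snd_sub, norm_sub_rev]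
    rwa [sub_add_cancel, h3] at h2
  have h4 : eNorm Y ^ 2 ≤ 2 * eNorm (X - Y) ^ 2 + 2 * eNorm X ^ 2 := by
    nlinarith [eNorm_nonneg Y, eNorm_nonneg X, eNorm_nonneg (X - Y),
      sq_nonneg (eNorm (X - Y) - eNorm X)]
  have h5 : 0 ≤ 1 / (8 * h) := by positivity
  have h6 : 1 / (4 * h) = 2 * (1 / (8 * h)) := by field_simp; norm_num
  rw [h6]
  nlinarith [mul_le_mul_of_nonneg_left h4 h5]

variable [FiniteDimensional ℝ E] [MeasurableSpace E] [BorelSpace E]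

instance isAddHaarMeasure_volume_prod : (volume : Measure (E × E)).IsAddHaarMeasure := by
  rw [Measure.volume_eq_prod]; infer_instance

lemma integrable_weight_mul_exp {c : ℝ} (hc : 0 < c) (d : ℝ) (m : ℕ) :
    Integrable fun Y : E × E => weight m Y * Real.exp (d * eNorm Y - c * eNorm Y ^ 2) := by
  have hc4 : 0 < c / 4 := by positivity
  have g1 : Integrable fun a : E => Real.exp (-(c / 4) * ‖a‖ ^ 2) := by
    have := (GaussianFourier.integrable_cexp_neg_mul_sq_norm_add (b := ((c / 4 : ℝ) : ℂ))
      (by simpa using hc4) 0 (0 : E)).norm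
    refine this.congr (Filter.Eventually.of_forall fun a => ?_)
    simp only [zero_mul, add_zero]
    rw [← Complex.ofReal_neg, ← Complex.ofReal_pow, ← Complex.ofReal_mul, Complex.norm_exp_ofReal]
  obtain ⟨C, hC, hb⟩ := exists_one_add_pow_mul_exp_le (by positivity : 0 < c / 2) m
  refine ((g1.mul_prod g1).const_mul (C * Real.exp (d ^ 2 / c))).mono'
    (by fun_prop) (Filter.Eventually.of_forall fun Y => ?_)
  have h1 := hb (eNorm Y) (eNorm_nonneg Y)
  have h2 : d * eNorm Y - c * eNorm Y ^ 2 ≤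
      -(c / 2) * eNorm Y ^ 2 + (d ^ 2 / c + -(c / 4) * eNorm Y ^ 2) := by
    have h3 : 0 ≤ c / 4 * (eNorm Y - 2 * d / c) ^ 2 := by positivity
    have h4 : c / 4 * (eNorm Y - 2 * d / c) ^ 2 = c / 4 * eNorm Y ^ 2 - d * eNorm Y + d ^ 2 / c := by
      field_simp
      ring
    linarith
  rw [Real.norm_eq_abs, abs_of_nonneg (mul_nonneg (weight_pos m Y).le (Real.exp_pos _).le)]
  calc weight m Y * Real.exp (d * eNorm Y - c * eNorm Y ^ 2)
      ≤ weight m Y * Real.exp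
          (-(c / 2) * eNorm Y ^ 2 + (d ^ 2 / c + -(c / 4) * eNorm Y ^ 2)) := by
        have := weight_pos m Y
        gcongr
    _ = (1 + eNorm Y) ^ m * Real.exp (-(c / 2) * eNorm Y ^ 2) *
          (Real.exp (d ^ 2 / c) * Real.exp (-(c / 4) * eNorm Y ^ 2)) := by
        rw [Real.exp_add, Real.exp_add, weight]; ring
    _ ≤ C * (Real.exp (d ^ 2 / c) * Real.exp (-(c / 4) * eNorm Y ^ 2)) := by gcongr
    _ = _ := by
        rw [eNorm_sq, mul_add, Real.exp_add]; ring

lemma integrable_weight_mul_kernel {h : ℝ} (hh : 0 < h) (m : ℕ) (X : E × E) :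
    Integrable fun Y => (weight m Y : ℂ) * kernel h X Y := by
  refine ((integrable_weight_mul_exp (by positivity : 0 < 1 / (8 * h)) 0 m).const_mul
    (Real.exp ((1 / (4 * h)) * eNorm X ^ 2))).mono' ?_ (Filter.Eventually.of_forall fun Y => ?_)
  · exact Continuous.aestronglyMeasurable (by fun_prop)
  · rw [norm_mul, Complex.norm_real, Real.norm_eq_abs, abs_of_pos (weight_pos m Y), zero_mul,
      zero_sub, ← neg_mul, mul_left_comm]
    exact mul_le_mul_of_nonneg_left (norm_kernel_le hh X Y) (weight_pos m Y).le

/-- The function `Y ↦ (1 + |Y|)^m ⟨Ψ_X, Ψ_Y⟩` in `L¹`. -/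
def kernelL1 {h : ℝ} (hh : 0 < h) (m : ℕ) (X : E × E) : E × E →₁[volume] ℂ :=
  (integrable_weight_mul_kernel hh m X).toL1 _

lemma coeFn_kernelL1 {h : ℝ} (hh : 0 < h) (m : ℕ) (X : E × E) :
    kernelL1 hh m X =ᵐ[volume] fun Y => (weight m Y : ℂ) * kernel h X Y :=
  Integrable.coeFn_toL1 _

lemma continuous_kernelL1 {h : ℝ} (hh : 0 < h) (m : ℕ) :
    Continuous (kernelL1 hh m : E × E → E × E →₁[volume] ℂ) := by
  rw [continuous_iff_continuousAt]
  intro X₀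
  rw [ContinuousAt, tendsto_iff_norm_sub_tendsto_zero]
  have h1 : ∀ X, ‖kernelL1 hh m X - kernelL1 hh m X₀‖ =
      ∫ Y, weight m Y * ‖kernel h X Y - kernel h X₀ Y‖ := fun X => by
    rw [L1.norm_eq_integral_norm]
    refine integral_congr_ae ?_
    filter_upwards [Lp.coeFn_sub (kernelL1 hh m X) (kernelL1 hh m X₀), coeFn_kernelL1 hh m X,
      coeFn_kernelL1 hh m X₀] with Y e1 e2 e3
    rw [e1, Pi.sub_apply, e2, e3, ← mul_sub, norm_mul, Complex.norm_real, Real.norm_eq_abs,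
      abs_of_pos (weight_pos m Y)]
  simp_rw [h1]
  have h2 : ContinuousAt (fun X => ∫ Y, weight m Y * ‖kernel h X Y - kernel h X₀ Y‖) X₀ := by
    have hnear : ∀ᶠ X in 𝓝 X₀, Real.exp ((1 / (4 * h)) * eNorm X ^ 2) <
        Real.exp ((1 / (4 * h)) * eNorm X₀ ^ 2) + 1 := by
      have : Continuous fun X : E × E => Real.exp ((1 / (4 * h)) * eNorm X ^ 2) := by fun_prop
      exact this.continuousAt.eventually_lt_const (by linarith)
    refine continuousAt_of_dominated (bound := fun Y =>
      (2 * Real.exp ((1 / (4 * h)) * eNorm X₀ ^ 2) + 1) *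
        (weight m Y * Real.exp (0 * eNorm Y - 1 / (8 * h) * eNorm Y ^ 2)))
      (Filter.Eventually.of_forall fun X => ?_) ?_
      ((integrable_weight_mul_exp (by positivity) 0 m).const_mul _)
      (Filter.Eventually.of_forall fun Y => ?_)
    · exact Continuous.aestronglyMeasurable (by fun_prop)
    · filter_upwards [hnear] with X hX
      refine Filter.Eventually.of_forall fun Y => ?_
      have hw := weight_pos m Y
      rw [norm_mul, norm_norm, Real.norm_eq_abs, abs_of_pos hw, mul_left_comm]
      refine mul_le_mul_of_nonneg_left ?_ hw.le
      refine (norm_sub_le _ _).trans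
        ((add_le_add (norm_kernel_le hh X Y) (norm_kernel_le hh X₀ Y)).trans ?_)
      rw [← add_mul, zero_mul, zero_sub, ← neg_mul]
      refine mul_le_mul_of_nonneg_right ?_ (Real.exp_pos _).le
      linarith
    · exact Continuous.continuousAt (by fun_prop)
  have h3 := h2.tendsto
  simpa using h3

lemma exists_norm_kernelL1_le {h : ℝ} (hh : 0 < h) (m : ℕ) :
    ∃ C : ℝ, ∀ X : E × E, ‖kernelL1 hh m X‖ ≤ C * weight m X := by
  refine ⟨∫ Y : E × E, weight m Y * Real.exp (0 * eNorm Y - 1 / (4 * h) * eNorm Y ^ 2),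
    fun X => ?_⟩
  have hi := integrable_weight_mul_exp (E := E) (by positivity : 0 < 1 / (4 * h)) 0 m
  rw [L1.norm_eq_integral_norm,
    ← integral_sub_right_eq_self
      (fun Y : E × E => weight m Y * Real.exp (0 * eNorm Y - 1 / (4 * h) * eNorm Y ^ 2)) X,
    ← integral_mul_const]
  refine integral_mono_ae (L1.integrable_coeFn _).norm ((hi.comp_sub_right X).mul_const _) ?_
  filter_upwards [coeFn_kernelL1 hh m X] with Y e
  have h1 : eNorm (X - Y) = eNorm (Y - X) := by
    simp only [eNorm, Prod.fst_sub, Prod.snd_sub, norm_sub_rev]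
  have h2 := weight_add_le m (Y - X) X
  rw [sub_add_cancel] at h2
  rw [e, norm_mul, norm_kernel, Complex.norm_real, Real.norm_eq_abs, abs_of_pos (weight_pos m Y),
    h1, zero_mul, zero_sub, ← neg_mul, mul_right_comm]
  exact mul_le_mul_of_nonneg_right h2 (Real.exp_pos _).le

/-- The normalized coherent states depend holomorphically on their center. -/
lemma differentiable_kernelL1 {h : ℝ} (hh : 0 < h) (m : ℕ) (A B : E × E) :
    Differentiable ℂ fun s : ℂ =>
      Complex.exp ((1 / (4 * h)) * eNorm (A + complexSMul s B) ^ 2) •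
        kernelL1 hh m (A + complexSMul s B) := by
  have hh' : (h : ℂ) ≠ 0 := by exact_mod_cast hh.ne'
  set p : E × E → ℂ := fun Y => (weight m Y : ℂ) *
    Complex.exp (-(1 / (4 * h)) * eNorm Y ^ 2 + (1 / (2 * h)) * herm A Y) with hp
  set β : E × E → ℂ := fun Y => (1 / (2 * h)) * herm B Y with hβ
  have hpc : Continuous p := by fun_prop
  have hβc : Continuous β := by fun_prop
  refine differentiable_L1_mul_cexp (p := p) (β := β) hpc.aestronglyMeasurable
    hβc.aestronglyMeasurable (fun c => ?_) fun s => ?_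
  · refine (integrable_weight_mul_exp (E := E) (by positivity : 0 < 1 / (4 * h))
      ((1 / (2 * h)) * (4 * eNorm A) + |c| * ((1 / (2 * h)) * (4 * eNorm B))) m).mono'
      (Continuous.aestronglyMeasurable (by fun_prop)) (Filter.Eventually.of_forall fun Y => ?_)
    have h2h : 0 ≤ 1 / (2 * h) := by positivity
    have n2h : ‖(1 / (2 * h) : ℂ)‖ = 1 / (2 * h) := by
      have : (1 / (2 * h) : ℂ) = ((1 / (2 * h) : ℝ) : ℂ) := by push_cast; rfl
      rw [this, Complex.norm_real, Real.norm_eq_abs, abs_of_nonneg h2h]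
    have b1 : ‖β Y‖ ≤ (1 / (2 * h)) * (4 * eNorm B * eNorm Y) := by
      rw [hβ, norm_mul, n2h]
      exact mul_le_mul_of_nonneg_left (norm_herm_le B Y) h2h
    have b2 : (-(1 / (4 * h)) * eNorm Y ^ 2 + (1 / (2 * h)) * herm A Y : ℂ).re ≤
        -(1 / (4 * h)) * eNorm Y ^ 2 + (1 / (2 * h)) * (4 * eNorm A * eNorm Y) := by
      rw [Complex.add_re]
      refine add_le_add (le_of_eq ?_) ?_
      · have : (-(1 / (4 * h)) * eNorm Y ^ 2 : ℂ) = ((-(1 / (4 * h)) * eNorm Y ^ 2 : ℝ) : ℂ) := by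
          push_cast; rfl
        rw [this, Complex.ofReal_re]
      · refine (Complex.re_le_norm _).trans ?_
        rw [norm_mul, n2h]
        exact mul_le_mul_of_nonneg_left (norm_herm_le A Y) h2h
    have b3 : c * ‖β Y‖ ≤ |c| * ((1 / (2 * h)) * (4 * eNorm B * eNorm Y)) :=
      (mul_le_mul_of_nonneg_right (le_abs_self c) (norm_nonneg _)).trans
        (mul_le_mul_of_nonneg_left b1 (abs_nonneg c))
    have hw := weight_pos m Y
    rw [norm_mul, norm_norm, Real.norm_eq_abs, abs_of_pos (Real.exp_pos _), hp, norm_mul,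
      Complex.norm_real, Real.norm_eq_abs, abs_of_pos hw, Complex.norm_exp, mul_assoc,
      ← Real.exp_add]
    refine mul_le_mul_of_nonneg_left (Real.exp_le_exp.2 ?_) hw.le
    linarith
  · filter_upwards [Lp.coeFn_smul (Complex.exp ((1 / (4 * h)) * eNorm (A + complexSMul s B) ^ 2))
      (kernelL1 hh m (A + complexSMul s B)), coeFn_kernelL1 hh m (A + complexSMul s B)] with Y e1 e2
    rw [e1, Pi.smul_apply, e2, smul_eq_mul, hp, hβ, kernel, herm_add_complexSMul, mul_left_comm,
      ← Complex.exp_add, mul_assoc, ← Complex.exp_add]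
    congr 2
    have n1 : ∀ Z : E × E, ((eNorm Z : ℝ) : ℂ) ^ 2 = (‖Z.1‖ : ℂ) ^ 2 + (‖Z.2‖ : ℂ) ^ 2 := fun Z => by
      exact_mod_cast congrArg (fun r : ℝ => (r : ℂ)) (eNorm_sq Z)
    rw [n1, n1]
    ring

end Kernel

end

end WienerSpace

namespace WienerSpace

noncomputable section

section GaussianIntegral

variable {E : Type*} [NormedAddCommGroup E] [InnerProductSpace ℝ E] [FiniteDimensional ℝ E]
  [MeasurableSpace E] [BorelSpace E]

lemma integral_cexp_neg_mul_sq_norm_add_inner {α : ℝ} (hα : 0 < α) (w₁ w₂ : E) :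
    ∫ x : E, Complex.exp (-α * ‖x‖ ^ 2 + (inner ℝ w₁ x : ℝ) + Complex.I * (inner ℝ w₂ x : ℝ)) =
      (Real.pi / α : ℂ) ^ (Module.finrank ℝ E / 2 : ℂ) *
        Complex.exp ((‖w₁‖ ^ 2 - ‖w₂‖ ^ 2 + 2 * Complex.I * (inner ℝ w₁ w₂ : ℝ)) / (4 * α)) := by
  have hα' : (α : ℂ) ≠ 0 := by exact_mod_cast hα.ne'
  have h1 := GaussianFourier.integral_cexp_neg_mul_sq_norm_add (b := (α : ℂ)) (by simpa using hα)
    Complex.I w₂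
  have h2 : ∀ x : E, Complex.exp (-α * ‖x + (1 / (2 * α)) • w₁‖ ^ 2 +
      (inner ℝ w₁ (x + (1 / (2 * α)) • w₁) : ℝ) +
      Complex.I * (inner ℝ w₂ (x + (1 / (2 * α)) • w₁) : ℝ)) =
      Complex.exp (-α * ‖x‖ ^ 2 + Complex.I * (inner ℝ w₂ x : ℝ)) *
        Complex.exp (‖w₁‖ ^ 2 / (4 * α) + Complex.I * (inner ℝ w₁ w₂ : ℝ) / (2 * α)) := by
    intro x
    rw [← Complex.exp_add]
    congr 1
    rw [← Complex.ofReal_pow ‖x + (1 / (2 * α)) • w₁‖, norm_add_sq_real, inner_add_right,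
      inner_add_right, inner_smul_right, inner_smul_right, inner_smul_right,
      real_inner_self_eq_norm_sq, norm_smul, mul_pow, Real.norm_eq_abs, sq_abs,
      real_inner_comm w₁ x, real_inner_comm w₁ w₂]
    push_cast
    field_simp
    ring
  rw [← integral_add_right_eq_self _ ((1 / (2 * α)) • w₁)]
  simp_rw [h2]
  rw [integral_mul_const, h1, mul_assoc, ← Complex.exp_add, Complex.I_sq]
  congr 2
  field_simp
  ring

/-- The coherent state `Ψ_{X,h}`, for `X ∈ E²`, as a function on `E`. -/
def coherentFunOn (h : ℝ) (X : E × E) (v : E) : ℂ :=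
  Complex.exp ((1 / h) * ((inner ℝ X.1 v : ℝ) + Complex.I * (inner ℝ X.2 v : ℝ))
    - (1 / (2 * h)) * ‖X.1‖ ^ 2 - (Complex.I / (2 * h)) * (inner ℝ X.1 X.2 : ℝ))

omit [FiniteDimensional ℝ E] [MeasurableSpace E] [BorelSpace E] in
lemma continuous_coherentFunOn (h : ℝ) :
    Continuous fun p : (E × E) × E => coherentFunOn h p.1 p.2 := by
  unfold coherentFunOn; fun_prop

omit [FiniteDimensional ℝ E] [MeasurableSpace E] [BorelSpace E] in
lemma norm_coherentFunOn_le {h : ℝ} (hh : 0 < h) (X : E × E) (v : E) :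
    ‖coherentFunOn h X v‖ ≤ Real.exp (1 / (2 * h) * ‖v‖ ^ 2) := by
  have e : ((1 / h) * ((inner ℝ X.1 v : ℝ) + Complex.I * (inner ℝ X.2 v : ℝ))
    - (1 / (2 * h)) * ‖X.1‖ ^ 2 - (Complex.I / (2 * h)) * (inner ℝ X.1 X.2 : ℝ) : ℂ) =
    (((1 / h) * inner ℝ X.1 v - (1 / (2 * h)) * ‖X.1‖ ^ 2 : ℝ) : ℂ) +
    (((1 / h) * inner ℝ X.2 v - (1 / (2 * h)) * inner ℝ X.1 X.2 : ℝ) : ℂ) * Complex.I := by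
    push_cast; ring
  rw [coherentFunOn, Complex.norm_exp, e, Complex.add_re, Complex.ofReal_re, Complex.re_ofReal_mul,
    Complex.I_re, mul_zero, add_zero, Real.exp_le_exp]
  have h1 : 0 ≤ 1 / (2 * h) * ‖X.1 - v‖ ^ 2 := by positivity
  rw [norm_sub_sq_real] at h1
  have h2 : 1 / h = 2 * (1 / (2 * h)) := by field_simp
  rw [h2]
  nlinarith

/-- The constant in the resolution of the identity by coherent states. -/
def resolutionConst (E : Type*) [NormedAddCommGroup E] [InnerProductSpace ℝ E] (h : ℝ) : ℂ :=
  (Real.pi / (1 / h : ℝ) : ℂ) ^ (Module.finrank ℝ E / 2 : ℂ) *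
    (Real.pi / (1 / (4 * h) : ℝ) : ℂ) ^ (Module.finrank ℝ E / 2 : ℂ)

omit [FiniteDimensional ℝ E] [MeasurableSpace E] [BorelSpace E] in
lemma resolutionConst_ne_zero {h : ℝ} (hh : 0 < h) : resolutionConst E h ≠ 0 := by
  have hh' : (h : ℂ) ≠ 0 := by exact_mod_cast hh.ne'
  have hpi : (Real.pi : ℂ) ≠ 0 := by exact_mod_cast Real.pi_ne_zero
  refine mul_ne_zero ?_ ?_
  · rw [Ne, Complex.cpow_eq_zero_iff]
    push_cast
    simp [hh', hpi]
  · rw [Ne, Complex.cpow_eq_zero_iff]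
    push_cast
    simp [hh', hpi]

lemma integral_coherentFunOn_mul_kernel {h : ℝ} (hh : 0 < h) (Y : E × E) (v : E) :
    ∫ X : E × E, (starRingEnd ℂ) (coherentFunOn h X v) * kernel h X Y =
      resolutionConst E h * (starRingEnd ℂ) (coherentFunOn h Y v) := by
  have hh' : (h : ℂ) ≠ 0 := by exact_mod_cast hh.ne'
  have hc : Continuous fun X : E × E => (starRingEnd ℂ) (coherentFunOn h X v) * kernel h X Y := by
    unfold coherentFunOn; fun_prop
  have hi : Integrable fun X : E × E => (starRingEnd ℂ) (coherentFunOn h X v) * kernel h X Y := by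
    refine ((integrable_weight_mul_exp (by positivity : 0 < 1 / (8 * h)) 0 0).const_mul
      (Real.exp (1 / (2 * h) * ‖v‖ ^ 2) * Real.exp ((1 / (4 * h)) * eNorm Y ^ 2))).mono'
      hc.aestronglyMeasurable (Filter.Eventually.of_forall fun X => ?_)
    have h1 : ‖kernel h X Y‖ = ‖kernel h Y X‖ := by
      simp only [norm_kernel, eNorm, Prod.fst_sub, Prod.snd_sub, norm_sub_rev]
    rw [norm_mul, RCLike.norm_conj, h1, weight, pow_zero, one_mul, zero_mul, zero_sub, ← neg_mul,
      mul_assoc]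
    exact mul_le_mul (norm_coherentFunOn_le hh X v) (norm_kernel_le hh Y X) (norm_nonneg _)
      (Real.exp_pos _).le
  obtain ⟨p, q⟩ := Y
  rw [Measure.volume_eq_prod] at hi ⊢
  rw [integral_prod _ hi]
  set R : E → ℂ := fun a => (1 / h) * (inner ℝ a v : ℝ) - (1 / (2 * h)) * ‖a‖ ^ 2 -
    (1 / (4 * h)) * (‖a‖ ^ 2 + ‖p‖ ^ 2 + ‖q‖ ^ 2) + (1 / (2 * h)) * ((inner ℝ a p : ℝ) -
      Complex.I * (inner ℝ a q : ℝ)) with hR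
  have h1 : ∀ a b : E, (starRingEnd ℂ) (coherentFunOn h (a, b) v) * kernel h (a, b) (p, q) =
      Complex.exp (R a) * Complex.exp (-(1 / (4 * h) : ℝ) * ‖b‖ ^ 2 +
        (inner ℝ ((1 / (2 * h)) • q) b : ℝ) +
        Complex.I * (inner ℝ ((1 / (2 * h)) • (a + p - (2 : ℝ) • v)) b : ℝ)) := by
    intro a b
    rw [coherentFunOn, kernel, ← Complex.exp_conj, ← Complex.exp_add, ← Complex.exp_add]
    congr 1
    simp only [herm, hR, map_sub, map_mul, map_add, map_div₀, Complex.conj_ofReal, Complex.conj_I,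
      map_one, map_pow, map_ofNat, inner_smul_left, inner_sub_left, inner_add_left, conj_trivial]
    rw [real_inner_comm b p, real_inner_comm b q, real_inner_comm b v]
    push_cast
    field_simp
    ring
  set S : ℂ := (1 / (4 * h)) * (-‖p‖ ^ 2 - (‖p‖ ^ 2 - 4 * (inner ℝ p v : ℝ) + 4 * ‖v‖ ^ 2) +
    2 * Complex.I * ((inner ℝ p q : ℝ) - 2 * (inner ℝ q v : ℝ))) with hS
  have h2 : ∀ a : E, Complex.exp (R a) * Complex.exp ((‖(1 / (2 * h)) • q‖ ^ 2 -
      ‖(1 / (2 * h)) • (a + p - (2 : ℝ) • v)‖ ^ 2 + 2 * Complex.I *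
      (inner ℝ ((1 / (2 * h)) • q) ((1 / (2 * h)) • (a + p - (2 : ℝ) • v)) : ℝ)) /
        (4 * (1 / (4 * h) : ℝ))) =
      Complex.exp S * Complex.exp (-(1 / h : ℝ) * ‖a‖ ^ 2 + (inner ℝ ((2 / h) • v) a : ℝ) +
        Complex.I * (inner ℝ (0 : E) a : ℝ)) := by
    intro a
    rw [← Complex.exp_add, ← Complex.exp_add]
    congr 1
    rw [← Complex.ofReal_pow ‖(1 / (2 * h)) • q‖,
      ← Complex.ofReal_pow ‖(1 / (2 * h)) • (a + p - (2 : ℝ) • v)‖, norm_smul, norm_smul, mul_pow,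
      mul_pow, Real.norm_eq_abs, sq_abs, norm_sub_sq_real, norm_add_sq_real, norm_smul, mul_pow,
      Real.norm_eq_abs, sq_abs]
    simp only [hR, hS, inner_smul_left, inner_smul_right, inner_sub_right, inner_add_left,
      inner_add_right, conj_trivial, inner_zero_left]
    rw [real_inner_comm a v, real_inner_comm a q, real_inner_comm p q]
    push_cast
    field_simp
    ring
  have h3 : ∀ a : E, ∫ b : E, (starRingEnd ℂ) (coherentFunOn h (a, b) v) * kernel h (a, b) (p, q) =
      (Real.pi / (1 / (4 * h) : ℝ) : ℂ) ^ (Module.finrank ℝ E / 2 : ℂ) * (Complex.exp S *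
        Complex.exp (-(1 / h : ℝ) * ‖a‖ ^ 2 + (inner ℝ ((2 / h) • v) a : ℝ) +
        Complex.I * (inner ℝ (0 : E) a : ℝ))) := by
    intro a
    simp_rw [h1 a]
    rw [integral_const_mul, integral_cexp_neg_mul_sq_norm_add_inner (by positivity), mul_left_comm,
      h2]
  simp_rw [h3]
  rw [integral_const_mul, integral_const_mul,
    integral_cexp_neg_mul_sq_norm_add_inner (by positivity : 0 < 1 / h)]
  rw [resolutionConst, coherentFunOn, ← Complex.exp_conj]
  rw [mul_left_comm (Complex.exp S), ← Complex.exp_add, ← mul_assoc]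
  refine congrArg₂ (· * ·) (mul_comm _ _) (congrArg Complex.exp ?_)
  rw [← Complex.ofReal_pow ‖(2 / h) • v‖, norm_smul, mul_pow, Real.norm_eq_abs, sq_abs]
  simp only [hS, map_sub, map_mul, map_add, map_div₀, Complex.conj_ofReal, Complex.conj_I,
      map_one, map_pow, map_ofNat, inner_zero_right, norm_zero]
  push_cast
  field_simp
  ring

end GaussianIntegral

section Reproducing

variable {H B : Type*} [NormedAddCommGroup H] [InnerProductSpace ℝ H] [CompleteSpace H]
  [MeasurableSpace H] [BorelSpace H] [NormedAddCommGroup B] [NormedSpace ℝ B] [MeasurableSpace B]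
  [BorelSpace B] (W : AbstractWienerSpace H B) (h : ℝ) [Fact (0 < h)]
  (E : Submodule ℝ H) [FiniteDimensional ℝ E]

omit [MeasurableSpace H] [BorelSpace H] in
lemma coherent_ae_eq_coherentFunOn (X : E × E) :
    coherent W h (X.1, X.2) =ᵐ[mu W h] fun x => coherentFunOn h X (proj W h E x) := by
  filter_upwards [coeFn_coherent W h (X.1, X.2), inner_proj_ae W h E X.1, inner_proj_ae W h E X.2]
    with x e1 e2 e3
  rw [e1, coherentFun, coherentFunOn, e2, e3]
  rfl

omit [MeasurableSpace H] [BorelSpace H] [FiniteDimensional ℝ E] in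
lemma inner_coherent_eq_kernel (X Y : E × E) :
    inner ℂ (coherent W h (Y.1, Y.2)) (coherent W h (X.1, X.2)) = kernel h X Y := by
  rw [inner_coherent, kernel, herm]
  rfl

omit [MeasurableSpace H] [BorelSpace H] [FiniteDimensional ℝ E] in
lemma norm_coherent_sq (X : E × E) : ‖coherent W h (X.1, X.2)‖ ^ 2 = 1 := by
  have h1 := inner_coherent_eq_kernel W h E X X
  rw [inner_self_eq_norm_sq_to_K] at h1
  have h2 := congrArg norm h1
  rw [norm_kernel, sub_self] at h2
  simpa [eNorm] using h2

lemma integral_norm_mul_norm_le {α : Type*} [MeasurableSpace α] {μ : Measure α}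
    (f g : Lp ℂ 2 μ) : Integrable (fun x => ‖f x‖ * ‖g x‖) μ ∧
      ∫ x, ‖f x‖ * ‖g x‖ ∂μ ≤ (‖f‖ ^ 2 + ‖g‖ ^ 2) / 2 := by
  have h1 : ∀ f : Lp ℂ 2 μ, Integrable (fun x => ‖f x‖ ^ 2) μ ∧ ∫ x, ‖f x‖ ^ 2 ∂μ = ‖f‖ ^ 2 := by
    intro f
    refine ⟨(memLp_two_iff_integrable_sq_norm (Lp.aestronglyMeasurable f)).1 (Lp.memLp f), ?_⟩
    have h2 := L2.inner_def (𝕜 := ℂ) f f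
    simp_rw [inner_self_eq_norm_sq_to_K] at h2
    have h3 : ((‖f‖ ^ 2 : ℝ) : ℂ) = ((∫ x, ‖f x‖ ^ 2 ∂μ : ℝ) : ℂ) := by
      rw [← integral_complex_ofReal]
      push_cast
      exact h2
    exact_mod_cast h3.symm
  have h4 := ((h1 f).1.add (h1 g).1).div_const 2
  have h5 : ∀ x, ‖f x‖ * ‖g x‖ ≤ (‖f x‖ ^ 2 + ‖g x‖ ^ 2) / 2 := fun x => by
    nlinarith [sq_nonneg (‖f x‖ - ‖g x‖)]
  have h6 : Integrable (fun x => ‖f x‖ * ‖g x‖) μ := by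
    refine h4.mono' ((Lp.aestronglyMeasurable f).norm.mul (Lp.aestronglyMeasurable g).norm)
      (Filter.Eventually.of_forall fun x => ?_)
    rw [Real.norm_eq_abs, abs_of_nonneg (by positivity)]
    exact h5 x
  refine ⟨h6, (integral_mono h6 h4 h5).trans_eq ?_⟩
  simp only [Pi.add_apply]
  rw [integral_div, integral_add (h1 f).1 (h1 g).1, (h1 f).2, (h1 g).2]

omit [MeasurableSpace H] [BorelSpace H] in
lemma inner_coherent_eq_integral (X : E × E) (f : Lp ℂ 2 (mu W h)) :
    inner ℂ (coherent W h (X.1, X.2)) f =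
      ∫ x, f x * (starRingEnd ℂ) (coherentFunOn h X (proj W h E x)) ∂(mu W h) := by
  rw [L2.inner_def]
  refine integral_congr_ae ?_
  filter_upwards [coherent_ae_eq_coherentFunOn W h E X] with x e
  rw [e, RCLike.inner_apply]

/-- The resolution of the identity by coherent states. -/
lemma integral_inner_coherent_mul_kernel (f : Lp ℂ 2 (mu W h)) (Y : E × E) :
    ∫ X : E × E, inner ℂ (coherent W h (X.1, X.2)) f * kernel h X Y =
      resolutionConst E h * inner ℂ (coherent W h (Y.1, Y.2)) f := by
  have hh : 0 < h := Fact.out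
  set k : E × E → B → ℂ := fun X x =>
    f x * (starRingEnd ℂ) (coherentFunOn h X (proj W h E x)) * kernel h X Y with hk
  have hslice : ∀ X : E × E, (fun x => ‖k X x‖) =ᵐ[mu W h]
      fun x => (‖f x‖ * ‖coherent W h (X.1, X.2) x‖) * ‖kernel h X Y‖ := fun X => by
    filter_upwards [coherent_ae_eq_coherentFunOn W h E X] with x e
    rw [e, hk, norm_mul, norm_mul, RCLike.norm_conj]
  have hmeas : Measurable (Function.uncurry k) := by
    have m1 := (Lp.stronglyMeasurable f).measurable
    have m2 := measurable_proj W h E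
    have m3 : ∀ G : E × E → E → ℂ, Measurable (Function.uncurry G) →
        Measurable fun p : (E × E) × B => G p.1 (proj W h E p.2) := fun G hG =>
      hG.comp (measurable_fst.prodMk (m2.comp measurable_snd))
    have m4 := m3 (coherentFunOn h) (continuous_coherentFunOn (E := E) h).measurable
    have m5 := m3 (fun X _ => kernel h X Y)
      (by fun_prop : Continuous fun p : (E × E) × E => kernel h p.1 Y).measurable
    exact ((m1.comp measurable_snd).mul (Complex.continuous_conj.measurable.comp m4)).mul m5
  have hi : Integrable (Function.uncurry k) (volume.prod (mu W h)) := by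
    rw [integrable_prod_iff hmeas.aestronglyMeasurable]
    refine ⟨Filter.Eventually.of_forall fun X => ?_, ?_⟩
    · have m : Measurable (k X) := hmeas.comp measurable_prodMk_left
      refine (integrable_norm_iff m.aestronglyMeasurable).1 ?_
      exact (((integral_norm_mul_norm_le f _).1).mul_const _).congr (hslice X).symm
    · have hK : Integrable fun X : E × E => ‖kernel h X Y‖ := by
        have := (integrable_weight_mul_kernel hh 0 Y).norm
        refine this.congr (Filter.Eventually.of_forall fun X => ?_)
        simp only [weight, pow_zero, Complex.ofReal_one, one_mul, norm_kernel, eNorm, Prod.fst_sub,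
          Prod.snd_sub, norm_sub_rev]
      refine (hK.const_mul ((‖f‖ ^ 2 + 1) / 2)).mono'
        hmeas.norm.stronglyMeasurable.integral_prod_right.aestronglyMeasurable
        (Filter.Eventually.of_forall fun X => ?_)
      rw [Real.norm_eq_abs, abs_of_nonneg (integral_nonneg fun x => norm_nonneg _)]
      change ∫ x, ‖k X x‖ ∂(mu W h) ≤ _
      rw [integral_congr_ae (hslice X), integral_mul_const]
      refine mul_le_mul_of_nonneg_right ?_ (norm_nonneg _)
      refine (integral_norm_mul_norm_le f _).2.trans_eq ?_
      rw [norm_coherent_sq]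
  have h1 : ∀ X : E × E, inner ℂ (coherent W h (X.1, X.2)) f * kernel h X Y =
      ∫ x, k X x ∂(mu W h) := fun X => by
    rw [inner_coherent_eq_integral, ← integral_mul_const]
  simp_rw [h1]
  rw [integral_integral_swap hi, inner_coherent_eq_integral, ← integral_const_mul]
  refine integral_congr_ae (Filter.Eventually.of_forall fun x => ?_)
  simp only [hk, mul_assoc]
  rw [integral_const_mul, integral_coherentFunOn_mul_kernel hh]
  ring

end Reproducing

end

end WienerSpace

namespace WienerSpace

noncomputable section

lemma integrable_weight_mul_schwartz {E : Type*} [NormedAddCommGroup E] [InnerProductSpace ℝ E]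
    [FiniteDimensional ℝ E] [MeasurableSpace E] [BorelSpace E] (m : ℕ) (φ : 𝓢(E × E, ℂ)) :
    Integrable fun X => (weight m X : ℂ) * φ X := by
  have h1 := ((φ.integrable_pow_mul volume 0).add
    ((φ.integrable_pow_mul volume m).const_mul (2 ^ m))).const_mul (2 ^ (m - 1))
  have hφ := φ.continuous
  refine h1.mono' (Continuous.aestronglyMeasurable (by fun_prop))
    (Filter.Eventually.of_forall fun X => ?_)
  rw [norm_mul, Complex.norm_real, Real.norm_eq_abs, abs_of_pos (weight_pos m X)]
  have h2 : weight m X ≤ 2 ^ (m - 1) * (1 + 2 ^ m * ‖X‖ ^ m) := by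
    calc weight m X ≤ (1 + 2 * ‖X‖) ^ m :=
          pow_le_pow_left₀ (by linarith [eNorm_nonneg X]) (by linarith [eNorm_le_two_mul_norm X]) m
      _ ≤ 2 ^ (m - 1) * (1 ^ m + (2 * ‖X‖) ^ m) := add_pow_le zero_le_one (by positivity) m
      _ = _ := by rw [one_pow, mul_pow]
  refine (mul_le_mul_of_nonneg_right h2 (norm_nonneg _)).trans_eq ?_
  simp only [Pi.add_apply, pow_zero]
  ring

variable {H B : Type*} [NormedAddCommGroup H] [InnerProductSpace ℝ H] [CompleteSpace H]
  [MeasurableSpace H] [BorelSpace H] [NormedAddCommGroup B] [NormedSpace ℝ B] [MeasurableSpace B]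
  [BorelSpace B] (W : AbstractWienerSpace H B) (h : ℝ) [Fact (0 < h)]
  (E : Submodule ℝ H) [FiniteDimensional ℝ E]

lemma integrable_weight_mul_inner_coherent (m : ℕ) (f : domainOn W h E) :
    Integrable fun X : E × E => (weight m X : ℂ) *
      inner ℂ (coherent W h (X.1, X.2)) (f : Lp ℂ 2 (mu W h)) := by
  obtain ⟨φ, hφ⟩ := f.2.2
  simp_rw [← hφ]
  exact integrable_weight_mul_schwartz m φ

/-- The map which sends `f ∈ 𝒟_E` to the class of `X ↦ (1 + |X|)^m ⟨f, Ψ_{X,h}⟩` in `L¹(E²)`. -/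
def toWeightedL1 (m : ℕ) : domainOn W h E →ₗ[ℂ] (E × E →₁[volume] ℂ) where
  toFun f := (integrable_weight_mul_inner_coherent W h E m f).toL1 _
  map_add' f g := by
    rw [← Integrable.toL1_add]
    congr 1
    ext X
    simp only [Pi.add_apply, Submodule.coe_add, inner_add_right, mul_add]
  map_smul' c f := by
    rw [← Integrable.toL1_smul]
    congr 1
    ext X
    simp only [Submodule.coe_smul, inner_smul_right, smul_eq_mul, RingHom.id_apply]
    ring

lemma coeFn_toWeightedL1 (m : ℕ) (f : domainOn W h E) :
    toWeightedL1 W h E m f =ᵐ[volume] fun X : E × E => (weight m X : ℂ) *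
      inner ℂ (coherent W h (X.1, X.2)) (f : Lp ℂ 2 (mu W h)) :=
  (integrable_weight_mul_inner_coherent W h E m f).coeFn_toL1

lemma norm_toWeightedL1 (m : ℕ) (f : domainOn W h E) :
    ‖toWeightedL1 W h E m f‖ = seminormI W h E m f := by
  rw [L1.norm_eq_integral_norm, seminormI]
  refine integral_congr_ae ?_
  filter_upwards [coeFn_toWeightedL1 W h E m f] with X e
  rw [e, norm_mul, Complex.norm_real, Real.norm_eq_abs, abs_of_pos (weight_pos m X), mul_comm]
  rfl

lemma seminormI_nonneg (m : ℕ) (f : domainOn W h E) : 0 ≤ seminormI W h E m f := by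
  rw [← norm_toWeightedL1]; exact norm_nonneg _

lemma seminormI_mono {m n : ℕ} (hmn : m ≤ n) (f : domainOn W h E) :
    seminormI W h E m f ≤ seminormI W h E n f := by
  rw [← norm_toWeightedL1, ← norm_toWeightedL1, L1.norm_eq_integral_norm, L1.norm_eq_integral_norm]
  refine integral_mono_ae (L1.integrable_coeFn _).norm (L1.integrable_coeFn _).norm ?_
  filter_upwards [coeFn_toWeightedL1 W h E m f, coeFn_toWeightedL1 W h E n f] with X e1 e2
  rw [e1, e2, norm_mul, norm_mul, Complex.norm_real, Complex.norm_real, Real.norm_eq_abs,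
    Real.norm_eq_abs, abs_of_pos (weight_pos m X), abs_of_pos (weight_pos n X)]
  exact mul_le_mul_of_nonneg_right
    (pow_le_pow_right₀ (by linarith [eNorm_nonneg X]) hmn) (norm_nonneg _)

/-- The coherent state `Ψ_{X,h}`, for `X ∈ E²`, as an element of `𝒟_E`. -/
def coherentOn (X : E × E) : domainOn W h E :=
  ⟨coherent W h (X.1, X.2), coherent_mem_domainOn W h E (Subtype.mem _) (Subtype.mem _)⟩

lemma toWeightedL1_coherentOn (m : ℕ) (X : E × E) :
    toWeightedL1 W h E m (coherentOn W h E X) = kernelL1 (Fact.out : 0 < h) m X := by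
  refine Lp.ext ?_
  filter_upwards [coeFn_toWeightedL1 W h E m (coherentOn W h E X),
    coeFn_kernelL1 (Fact.out : 0 < h) m X] with Y e1 e2
  rw [e1, e2, coherentOn, inner_coherent_eq_kernel]

/-- The coherent states span a dense subspace of `𝒟_E` for the norm `I(E, m)`. -/
lemma apply_toWeightedL1_eq_zero {m : ℕ} (Λ : (E × E →₁[volume] ℂ) →L[ℂ] ℂ)
    (hΛ : ∀ X : E × E, Λ (toWeightedL1 W h E m (coherentOn W h E X)) = 0) (f : domainOn W h E) :
    Λ (toWeightedL1 W h E m f) = 0 := by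
  have hh : 0 < h := Fact.out
  obtain ⟨φ, hφ⟩ := f.2.2
  obtain ⟨C, hC⟩ := exists_norm_kernelL1_le (E := E) hh m
  have hcont := continuous_kernelL1 (E := E) hh m
  have hφc := φ.continuous
  have hmaj : Integrable fun X : E × E => ‖φ X‖ * ‖kernelL1 hh m X‖ := by
    refine ((integrable_weight_mul_schwartz m φ).norm.const_mul C).mono'
      (Continuous.aestronglyMeasurable (by fun_prop)) (Filter.Eventually.of_forall fun X => ?_)
    rw [norm_mul, norm_norm, norm_norm, norm_mul, Complex.norm_real, Real.norm_eq_abs,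
      abs_of_pos (weight_pos m X), ← mul_assoc, mul_comm]
    exact mul_le_mul_of_nonneg_right (hC X) (norm_nonneg _)
  have hκ : Integrable fun X : E × E => φ X • kernelL1 hh m X :=
    hmaj.mono' (hφc.smul hcont).aestronglyMeasurable
      (Filter.Eventually.of_forall fun X => (norm_smul _ _).le)
  set k : E × E → E × E → ℂ := fun X Y => φ X * ((weight m Y : ℂ) * kernel h X Y) with hk
  have hκk : ∀ X, (φ X • kernelL1 hh m X : E × E →₁[volume] ℂ) =ᵐ[volume] k X := fun X => by
    filter_upwards [Lp.coeFn_smul (φ X) (kernelL1 hh m X), coeFn_kernelL1 hh m X] with Y e1 e2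
    rw [e1, Pi.smul_apply, e2, smul_eq_mul]
  have hki : Integrable (Function.uncurry k) (volume.prod volume) := by
    have hkc : Continuous (Function.uncurry k) := by
      simp only [hk, Function.uncurry_def]
      fun_prop
    rw [integrable_prod_iff hkc.aestronglyMeasurable]
    refine ⟨Filter.Eventually.of_forall fun X => (L1.integrable_coeFn _).congr (hκk X), ?_⟩
    refine hmaj.congr (Filter.Eventually.of_forall fun X => ?_)
    change ‖φ X‖ * ‖kernelL1 hh m X‖ = ∫ Y, ‖k X Y‖
    rw [← norm_smul, L1.norm_eq_integral_norm]
    exact integral_congr_ae ((hκk X).fun_comp norm)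
  have h1 : ∫ X : E × E, φ X • kernelL1 hh m X =
      resolutionConst E h • toWeightedL1 W h E m f := by
    refine Lp.ext ?_
    filter_upwards [coeFn_integral_L1_ae_eq hκ hki hκk, coeFn_toWeightedL1 W h E m f,
      Lp.coeFn_smul (resolutionConst E h) (toWeightedL1 W h E m f)] with Y e1 e2 e3
    rw [e1, e3, Pi.smul_apply, e2, smul_eq_mul, mul_left_comm,
      ← integral_inner_coherent_mul_kernel, ← integral_const_mul]
    refine integral_congr_ae (Filter.Eventually.of_forall fun X => ?_)
    simp only [hk, hφ]
    ring
  have h2 : Λ (∫ X : E × E, φ X • kernelL1 hh m X) = 0 := by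
    rw [← ContinuousLinearMap.integral_comp_comm Λ hκ]
    refine integral_eq_zero_of_ae (Filter.Eventually.of_forall fun X => ?_)
    simp only [map_smul, Pi.zero_apply]
    rw [← toWeightedL1_coherentOn W h E, hΛ, smul_zero]
  rw [h1, map_smul, smul_eq_zero] at h2
  exact h2.resolve_left (resolutionConst_ne_zero hh)

variable {W h E} in
/-- A sesquilinear form on `𝒟_E` which is bounded for `I(E, m)` is determined by its Wick
symbol. -/
lemma sesquilinear_eq_zero_of_coherentOn {Q : domainOn W h E →ₗ[ℂ] domainOn W h E →ₗ⋆[ℂ] ℂ}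
    {C : ℝ} {m : ℕ}
    (hQ : ∀ f g, ‖Q f g‖ ≤ C * ‖toWeightedL1 W h E m f‖ * ‖toWeightedL1 W h E m g‖)
    (hwick : ∀ X, Q (coherentOn W h E X) (coherentOn W h E X) = 0) (f g : domainOn W h E) :
    Q f g = 0 := by
  have hh : 0 < h := Fact.out
  have hoff : ∀ X Y, Q (coherentOn W h E X) (coherentOn W h E Y) = 0 := by
    intro X Y
    set Z : ℂ → E × E := fun s => Y + complexSMul s (X - Y) with hZ
    set c : ℂ → ℂ := fun s => Complex.exp ((1 / (4 * h)) * eNorm (Z s) ^ 2) with hc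
    have h1 := sesquilinear_eq_zero_of_diagonal (u := fun s => c s • coherentOn W h E (Z s)) hQ
      (by
        simp_rw [map_smul, toWeightedL1_coherentOn]
        exact differentiable_kernelL1 hh m Y (X - Y))
      (fun s => by simp [hwick])
    have z1 : Z 1 = X := by ext <;> simp [hZ, complexSMul]
    have z0 : Z 0 = Y := by
      ext <;> simp [hZ, complexSMul]
    simp only [z1, z0, map_smul, LinearMap.smul_apply, map_smulₛₗ, smul_eq_mul, mul_eq_zero,
      map_eq_zero] at h1
    simpa [hc, Complex.exp_ne_zero] using h1
  have hleft : ∀ X, Q (coherentOn W h E X) g = 0 := by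
    intro X
    obtain ⟨Λ, hΛ⟩ := exists_continuousLinearMap_right hQ (coherentOn W h E X)
    have h1 := apply_toWeightedL1_eq_zero W h E Λ (fun Y => by rw [hΛ, hoff, map_zero]) g
    rwa [hΛ, map_eq_zero] at h1
  obtain ⟨Λ, hΛ⟩ := exists_continuousLinearMap_left hQ g
  have h1 := apply_toWeightedL1_eq_zero W h E Λ (fun X => by rw [hΛ, hleft]) f
  rwa [hΛ] at h1

omit [MeasurableSpace H] [BorelSpace H] in
lemma domainOn_le_domain : domainOn W h E ≤ domain W h := fun _ hf =>
  Set.mem_iUnion₂.2 ⟨E, inferInstance, hf⟩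

end

end WienerSpace

theorem lemma2p7 {H B : Type*}
    [NormedAddCommGroup H] [InnerProductSpace ℝ H] [CompleteSpace H]
    [TopologicalSpace.SeparableSpace H] [MeasurableSpace H] [BorelSpace H]
    [NormedAddCommGroup B] [NormedSpace ℝ B] [CompleteSpace B] [MeasurableSpace B] [BorelSpace B]
    (W : WienerSpace.AbstractWienerSpace H B) (h : ℝ) [Fact (0 < h)]
    (Q₁ Q₂ : WienerSpace.QuadForm W h)
    (hQ₁ : Q₁.IsContinuous) (hQ₂ : Q₂.IsContinuous)
    (hwick : ∀ X : H × H, Q₁.wickSymbol X = Q₂.wickSymbol X) :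
    Q₁ = Q₂ := by
  refine LinearMap.ext fun f => LinearMap.ext fun g => ?_
  obtain ⟨E₁, hE₁, hf⟩ := Set.mem_iUnion₂.1 f.2
  obtain ⟨E₂, hE₂, hg⟩ := Set.mem_iUnion₂.1 g.2
  set E := E₁ ⊔ E₂ with hE
  have hfE : (f : Lp ℂ 2 (WienerSpace.mu W h)) ∈ WienerSpace.domainOn W h E :=
    WienerSpace.domainOn_mono W h le_sup_left hf
  have hgE : (g : Lp ℂ 2 (WienerSpace.mu W h)) ∈ WienerSpace.domainOn W h E :=
    WienerSpace.domainOn_mono W h le_sup_right hg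
  obtain ⟨C₁, hC₁, m₁, hb₁⟩ := hQ₁ E
  obtain ⟨C₂, hC₂, m₂, hb₂⟩ := hQ₂ E
  set J := Submodule.inclusion (WienerSpace.domainOn_le_domain W h E) with hJ
  have hbound : ∀ a b : WienerSpace.domainOn W h E, ‖((Q₁ - Q₂).comp J).compl₂ J a b‖ ≤ (C₁ + C₂) *
      ‖WienerSpace.toWeightedL1 W h E (max m₁ m₂) a‖ *
      ‖WienerSpace.toWeightedL1 W h E (max m₁ m₂) b‖ := by
    intro a b
    rw [WienerSpace.norm_toWeightedL1, WienerSpace.norm_toWeightedL1]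
    have n := fun k (a : WienerSpace.domainOn W h E) => WienerSpace.seminormI_nonneg W h E k a
    have l₁ := fun a : WienerSpace.domainOn W h E =>
      WienerSpace.seminormI_mono W h E (le_max_left m₁ m₂) a
    have l₂ := fun a : WienerSpace.domainOn W h E =>
      WienerSpace.seminormI_mono W h E (le_max_right m₁ m₂) a
    calc ‖Q₁ (J a) (J b) - Q₂ (J a) (J b)‖ ≤ ‖Q₁ (J a) (J b)‖ + ‖Q₂ (J a) (J b)‖ := norm_sub_le _ _
      _ ≤ C₁ * WienerSpace.seminormI W h E m₁ a * WienerSpace.seminormI W h E m₁ b +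
          C₂ * WienerSpace.seminormI W h E m₂ a * WienerSpace.seminormI W h E m₂ b :=
        add_le_add (hb₁ _ _ a.2 b.2) (hb₂ _ _ a.2 b.2)
      _ ≤ C₁ * WienerSpace.seminormI W h E (max m₁ m₂) a *
            WienerSpace.seminormI W h E (max m₁ m₂) b +
          C₂ * WienerSpace.seminormI W h E (max m₁ m₂) a *
            WienerSpace.seminormI W h E (max m₁ m₂) b := by
        have := n m₁ b
        have := n m₂ b
        have := n (max m₁ m₂) a
        gcongr
        exacts [l₁ a, l₁ b, l₂ a, l₂ b]
      _ = _ := by ring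
  have h0 := WienerSpace.sesquilinear_eq_zero_of_coherentOn hbound
    (fun X => sub_eq_zero.2 (hwick (X.1, X.2))) ⟨f, hfE⟩ ⟨g, hgE⟩
  exact sub_eq_zero.1 h0
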